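/- **Setting.** Fix a bidegree $\boldsymbol p=(p_1,p_2)$ of non-negative integers. A *1-split* (*2-split*) is a vertical (horizontal) segment with a multiplicity $\mu\ge 1$. *LR-meshes.* An LR-mesh $\mathcal M$ on an axis-aligned rectangle $\Omega$ is a box-partition of $\Omega$ whose edges carry multiplicities, obtained as $\mathcal M=\mathcal M_N$ from a sequence $\mathcal M_1$, $\mathcal M_{i+1}=\mathcal M_i+\gamma_i$, where: $\mathcal M_1$ is a tensor product mesh with at least $p_1+2$ vertical and $p_2+2$ horizontal splits, counted with multiplicity; every $\gamma_i$ is a finite union of contiguous collinear segments, each of which either cuts an element of the current partition from side to side or is an edge already in $\mathcal M_i$ (inserting $\gamma_i$ cuts the elements it traverses and adds its multiplicity along it); in each $\mathcal M_{i}$ the edges of any maximal split all have the same multiplicity; and each maximal $k$-split of each $\mathcal M_i$ meets at least $p_{3-k}+2$ orthogonal splits, counted with multiplicity. *MS B-splines.* A B-spline $B[\boldsymbol x,\boldsymbol y](x,y)=B[\boldsymbol x](x)\,B[\boldsymbol y](y)$ of bidegree $\boldsymbol p$ is given by nondecreasing knot vectors with $p_1+2$ and $p_2+2$ entries, neither of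 them constant; its support is $[x_1,x_{p_1+2}]\times[y_1,y_{p_2+2}]$, and its splits are the segments $\{x_i\}\times[y_1,y_{p_2+2}]$ and $[x_1,x_{p_1+2}]\times\{y_j\}$, with the multiplicities of the knots. It is a *minimal support* (MS) B-spline on $\mathcal M$ if its support lies in $\Omega$, each of its splits of multiplicity $m$ is contained in a split of $\mathcal M$ of multiplicity at least $m$, and every split of $\mathcal M$ that divides the interior of its support contains a split of it of the same multiplicity. *LR B-splines.* Given a construction $\mathcal M_1,\dots,\mathcal M_N$ of $\mathcal M$ as above, the LR B-splines on $\mathcal M$ are obtained as follows. Start with the tensor product B-splines on consecutive knots of $\mathcal M_1$; after each insertion $\mathcal M_{i+1}=\mathcal M_i+\gamma_i$, as long as the current collection contains a B-spline without minimal support on $\mathcal M_{i+1}$, replace it by the two B-splines produced by inserting a knot given by a split of $\mathcal M_{i+1}$ that divides the interior of its support and has larger multiplicity than the corresponding knot. *Nestedness.* $B$ is *nested into* $B'$ if $\operatorname{supp}B\subset\operatorname{supp}B'$ and the two supports have exactly one vertex in common. **Proposition 6.8.** Let $\mathcal M$ be an LR-mesh and let six distinct MS B-splines of bidegree $\boldsymbol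 p$ on $\mathcal M$ be linearly dependent with all six coefficients nonzero, i.e. a linear combination of them with nonzero coefficients vanishes identically on $\mathbb R^2$. Then they can be labelled $B^1,\dots,B^6$ so that $\operatorname{supp}B^1$ is the union $\mathcal R$ of the six supports and $B^2,B^3,B^4,B^5$ are nested into $B^1$ at the lower left, upper left, upper right and lower right vertex of $\mathcal R$, respectively. For every such labelling the sixth B-spline $B^6$ is not an LR B-spline on $\mathcal M$, whatever the construction of $\mathcal M$ and the order of the knot insertions. -/

import Mathlib

noncomputable section

namespace LRSpline

/- Conventions.  The plane is `Fin 2 → ℝ`.  Direction `k : Fin 2` is the coordinate that is constant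
along a segment: direction `0` means vertical (`x` is constant), direction `1` horizontal.  The other
coordinate is `1 - k`. -/

/-! ### Rectangles, splits, box-partitions -/

/-- An axis-aligned rectangle `[lo 0, hi 0] × [lo 1, hi 1]`. -/
structure Rect where
  lo : Fin 2 → ℝ
  hi : Fin 2 → ℝ

/-- The points of a rectangle. -/
def Rect.toSet (β : Rect) : Set (Fin 2 → ℝ) := Set.Icc β.lo β.hi

/-- The four vertices of a rectangle. -/
def Rect.vertices (β : Rect) : Set (Fin 2 → ℝ) := {v | ∀ k, v k = β.lo k ∨ v k = β.hi k}

/-- An axis-aligned segment with a multiplicity: the points whose coordinate `dir` is `pos` and whose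
other coordinate lies in `[lo, hi]`. -/
structure Split where
  dir : Fin 2
  pos : ℝ
  lo : ℝ
  hi : ℝ
  mult : ℕ

/-- `γ` traverses `β`: it divides the interior of `β` into two pieces. -/
def Split.Traverses (γ : Split) (β : Rect) : Prop :=
  β.lo γ.dir < γ.pos ∧ γ.pos < β.hi γ.dir ∧
    γ.lo ≤ β.lo (1 - γ.dir) ∧ β.hi (1 - γ.dir) ≤ γ.hi

/-- The two closed rectangles into which `γ` cuts a rectangle `β` that it traverses. -/
def Split.pieces (γ : Split) (β : Rect) : Set Rect :=
  {⟨β.lo, Function.update β.hi γ.dir γ.pos⟩, ⟨Function.update β.lo γ.dir γ.pos, β.hi⟩}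

/-- The point with coordinate `k` equal to `a` and the other coordinate equal to `s`. -/
def point (k : Fin 2) (a s : ℝ) : Fin 2 → ℝ := fun i => if i = k then a else s

/-- The vertices of a box-partition. -/
def vertexSet (E : Set Rect) : Set (Fin 2 → ℝ) := {v | ∃ β ∈ E, v ∈ β.vertices}

/-- The segment of direction `k` at position `a` from `c` to `d` is a meshline of the box-partition
`E`: it lies on an edge of an element, and it joins two vertices with no further vertex on it. -/
def IsMeshline (E : Set Rect) (k : Fin 2) (a c d : ℝ) : Prop :=
  c < d ∧ point k a c ∈ vertexSet E ∧ point k a d ∈ vertexSet E ∧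
    (∀ s ∈ Set.Ioo c d, point k a s ∉ vertexSet E) ∧
    ∃ β ∈ E, (a = β.lo k ∨ a = β.hi k) ∧ β.lo (1 - k) ≤ c ∧ d ≤ β.hi (1 - k)

/-- `γ` may be inserted into the box-partition `E`: it is a finite union of contiguous collinear
segments, each of which either traverses an element from side to side or is a meshline. -/
def IsSplit (E : Set Rect) (γ : Split) : Prop :=
  γ.lo < γ.hi ∧ 0 < γ.mult ∧
    ∃ (n : ℕ) (t : Fin (n + 1) → ℝ), StrictMono t ∧ t 0 = γ.lo ∧ t (Fin.last n) = γ.hi ∧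
      ∀ i : Fin n,
        (∃ β ∈ E, β.lo γ.dir < γ.pos ∧ γ.pos < β.hi γ.dir ∧
          t i.castSucc = β.lo (1 - γ.dir) ∧ t i.succ = β.hi (1 - γ.dir)) ∨
        IsMeshline E γ.dir γ.pos (t i.castSucc) (t i.succ)

/-! ### Extended box-meshes -/

/-- A box-mesh with multiplicities: its rectangle `dom`, the elements of its box-partition, and the
splits (with their multiplicities) of which it is the superposition. -/
structure Mesh where
  dom : Rect
  elems : Set Rect
  splits : List Split

/-- The multiplicity of the meshline of direction `k` at position `a` that contains the points with
other coordinate slightly larger than `s` (`0` if there is none): the total multiplicity of the splits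
that contain it.  Since splits end at vertices, the multiplicity of the meshline from `c` to `d` is
the value for any `s` with `c ≤ s < d`. -/
def Mesh.multAbove (M : Mesh) (k : Fin 2) (a s : ℝ) : ℕ :=
  (M.splits.map fun γ =>
    if γ.dir = k ∧ γ.pos = a ∧ γ.lo ≤ s ∧ s < γ.hi then γ.mult else 0).sum

/-- As `multAbove`, for the points with other coordinate slightly smaller than `s`. -/
def Mesh.multBelow (M : Mesh) (k : Fin 2) (a s : ℝ) : ℕ :=
  (M.splits.map fun γ =>
    if γ.dir = k ∧ γ.pos = a ∧ γ.lo < s ∧ s ≤ γ.hi then γ.mult else 0).sum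

/-- The `k`-multiplicity of a point: the largest multiplicity of a `k`-meshline containing it. -/
def Mesh.vertexMult (M : Mesh) (k : Fin 2) (a s : ℝ) : ℕ :=
  max (M.multAbove k a s) (M.multBelow k a s)

/-- The segment of direction `k` at position `a` from `c` to `d` is covered by meshlines, that is, it
is contained in a split of the mesh. -/
def Mesh.Covers (M : Mesh) (k : Fin 2) (a c d : ℝ) : Prop :=
  ∀ s ∈ Set.Ico c d, 0 < M.multAbove k a s

/-- The segment of direction `k` at position `a` from `c` to `d` is a maximal split. -/
def Mesh.IsMaximalSplit (M : Mesh) (k : Fin 2) (a c d : ℝ) : Prop :=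
  c < d ∧ M.Covers k a c d ∧ M.multBelow k a c = 0 ∧ M.multAbove k a d = 0

/-- All meshlines of a maximal split have the same multiplicity. -/
def Mesh.HasConstantSplits (M : Mesh) : Prop :=
  ∀ k a c d, M.IsMaximalSplit k a c d →
    ∀ s ∈ Set.Ico c d, ∀ s' ∈ Set.Ico c d, M.multAbove k a s = M.multAbove k a s'

/-- The length of the segment of direction `k` at position `a` from `c` to `d`: the number of
orthogonal splits that it meets, counted with multiplicity. -/
def Mesh.length (M : Mesh) (k : Fin 2) (a c d : ℝ) : ℕ :=
  ∑ b ∈ (M.splits.map Split.pos).toFinset with c ≤ b ∧ b ≤ d, M.vertexMult (1 - k) b a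

/-- The mesh `M + γ`.  The multiplicity of `γ` is added on the meshlines contained in `γ`. -/
def Mesh.insert (M : Mesh) (γ : Split) : Mesh where
  dom := M.dom
  elems := {β ∈ M.elems | ¬ γ.Traverses β} ∪ ⋃ β ∈ {β ∈ M.elems | γ.Traverses β}, γ.pieces β
  splits := γ :: M.splits

/-- The first entry of a knot vector. -/
def firstKnot (l : List ℝ) : ℝ := l.headD 0

/-- The last entry of a knot vector. -/
def lastKnot (l : List ℝ) : ℝ := l.getLastD 0

/-- The tensor product mesh of two knot vectors; a knot that occurs `m` times gives a split of
multiplicity `m`, running through the whole rectangle. -/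
def tensorMesh (T : Fin 2 → List ℝ) : Mesh where
  dom := ⟨fun k => firstKnot (T k), fun k => lastKnot (T k)⟩
  elems := {β | ∀ k, β.lo k ∈ T k ∧ β.hi k ∈ T k ∧ β.lo k < β.hi k ∧
    ∀ a ∈ T k, a ≤ β.lo k ∨ β.hi k ≤ a}
  splits := (T 0).map (fun a => ⟨0, a, firstKnot (T 1), lastKnot (T 1), 1⟩) ++
    (T 1).map (fun a => ⟨1, a, firstKnot (T 0), lastKnot (T 0), 1⟩)

/-- The initial knot vectors: nondecreasing, spanning a nondegenerate rectangle, and with at least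
`p k + 2` entries in direction `k`. -/
def IsInitial (p : Fin 2 → ℕ) (T : Fin 2 → List ℝ) : Prop :=
  ∀ k, (T k).Pairwise (· ≤ ·) ∧ firstKnot (T k) < lastKnot (T k) ∧ p k + 2 ≤ (T k).length

/-- Every maximal `k`-split has length at least `p (1 - k) + 2`. -/
def Mesh.LongSplits (p : Fin 2 → ℕ) (M : Mesh) : Prop :=
  ∀ k a c d, M.IsMaximalSplit k a c d → p (1 - k) + 2 ≤ M.length k a c d

/-- `M + γ` is an admissible refinement of `M`. -/
def AdmissibleInsertion (p : Fin 2 → ℕ) (M : Mesh) (γ : Split) : Prop :=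
  IsSplit M.elems γ ∧ (M.insert γ).HasConstantSplits ∧ (M.insert γ).LongSplits p

/-- LR-meshes for the bidegree `p`. -/
inductive IsLRMesh (p : Fin 2 → ℕ) : Mesh → Prop
  | tensor (T : Fin 2 → List ℝ) (hT : IsInitial p T) : IsLRMesh p (tensorMesh T)
  | insert (M : Mesh) (γ : Split) (hM : IsLRMesh p M) (hγ : AdmissibleInsertion p M γ) :
      IsLRMesh p (M.insert γ)

/-! ### B-splines -/

/-- The Cox-de Boor recursion: the B-spline of degree `d` on the knots `t i, …, t (i + d + 1)`.
Division by zero gives zero, which is the usual convention. -/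
def coxDeBoor (t : ℕ → ℝ) : ℕ → ℕ → ℝ → ℝ
  | 0, i, z => if t i ≤ z ∧ z < t (i + 1) then 1 else 0
  | d + 1, i, z =>
      (z - t i) / (t (i + d + 1) - t i) * coxDeBoor t d i z +
      (t (i + d + 2) - z) / (t (i + d + 2) - t (i + 1)) * coxDeBoor t d (i + 1) z

/-- A bivariate tensor product B-spline of bidegree `p`, given by its two knot vectors, which are
nondecreasing, with `p k + 2` entries that are not all equal. -/
@[ext]
structure BSpline (p : Fin 2 → ℕ) where
  knots : Fin 2 → List ℝ
  sorted : ∀ k, (knots k).Pairwise (· ≤ ·)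
  length_eq : ∀ k, (knots k).length = p k + 2
  nondeg : ∀ k, firstKnot (knots k) < lastKnot (knots k)

namespace BSpline

variable {p : Fin 2 → ℕ}

/-- The function `B[x, y] : ℝ² → ℝ`, the product of the two univariate B-splines. -/
def eval (B : BSpline p) (z : Fin 2 → ℝ) : ℝ :=
  ∏ k, coxDeBoor (fun i => (B.knots k).getD i 0) (p k) 0 (z k)

/-- The support `[x₁, x_{p₁+2}] × [y₁, y_{p₂+2}]`. -/
def supp (B : BSpline p) : Rect :=
  ⟨fun k => firstKnot (B.knots k), fun k => lastKnot (B.knots k)⟩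

/-- `B` has support in `M`: its support lies in the domain, and every split of `B` of multiplicity `m`
is contained in a split of `M` of multiplicity at least `m`. -/
def HasSupport (M : Mesh) (B : BSpline p) : Prop :=
  B.supp.toSet ⊆ M.dom.toSet ∧
    ∀ k, ∀ a ∈ B.knots k, ∀ s ∈ Set.Ico (B.supp.lo (1 - k)) (B.supp.hi (1 - k)),
      (B.knots k).count a ≤ M.multAbove k a s

/-- `B` has minimal support in `M`: in addition, whenever a split of `M` traverses the support of `B`,
it is a split of `B` with the same multiplicity.  (Conversely, a split of `B` in the interior of the
support is contained in a split of `M`, which then traverses the support.) -/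
def HasMinimalSupport (M : Mesh) (B : BSpline p) : Prop :=
  B.HasSupport M ∧
    ∀ k a, B.supp.lo k < a → a < B.supp.hi k →
      M.Covers k a (B.supp.lo (1 - k)) (B.supp.hi (1 - k)) →
      ∀ s ∈ Set.Ico (B.supp.lo (1 - k)) (B.supp.hi (1 - k)),
        M.multAbove k a s = (B.knots k).count a

/-- `B` is nested into `B'`: the support of `B` is contained in that of `B'`, and the two supports
have exactly one vertex in common. -/
def IsNestedInto (B B' : BSpline p) : Prop :=
  B.supp.toSet ⊆ B'.supp.toSet ∧ ∃! v, v ∈ B.supp.vertices ∧ v ∈ B'.supp.vertices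

/-- `B` is nested into `B'` and the common vertex is `v`. -/
def IsNestedAt (v : Fin 2 → ℝ) (B B' : BSpline p) : Prop :=
  B.IsNestedInto B' ∧ v ∈ B.supp.vertices ∧ v ∈ B'.supp.vertices

end BSpline

/-! ### Knot insertion and LR B-splines -/

theorem lastKnot_eq {l : List ℝ} (h : l ≠ []) : lastKnot l = l.getLast h := by
  cases l with
  | nil => exact absurd rfl h
  | cons a l => rw [lastKnot, List.getLastD_cons, List.getLast_eq_getLastD]

theorem le_lastKnot {l : List ℝ} (hl : l.Pairwise (· ≤ ·)) {a : ℝ} (ha : a ∈ l) :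
    a ≤ lastKnot l := by
  have hne : l ≠ [] := List.ne_nil_of_mem ha
  rw [lastKnot_eq hne]
  rw [← List.dropLast_append_getLast hne] at hl ha
  rcases List.mem_append.1 ha with h | h
  · exact (List.pairwise_append.1 hl).2.2 a h _ (by simp)
  · exact (List.mem_singleton.1 h).le

theorem firstKnot_le {l : List ℝ} (hl : l.Pairwise (· ≤ ·)) {a : ℝ} (ha : a ∈ l) :
    firstKnot l ≤ a := by
  cases l with
  | nil => simp at ha
  | cons b l =>
    rcases List.mem_cons.1 ha with h | h
    · simp [firstKnot, h]
    · simpa [firstKnot] using (List.pairwise_cons.1 hl).1 a h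

theorem firstKnot_mem {l : List ℝ} (h : l ≠ []) : firstKnot l ∈ l := by
  cases l with
  | nil => exact absurd rfl h
  | cons b l => simp [firstKnot]

theorem lastKnot_mem {l : List ℝ} (h : l ≠ []) : lastKnot l ∈ l := by
  rw [lastKnot_eq h]; exact List.getLast_mem h

theorem firstKnot_lt_lastKnot {l : List ℝ} (hl : l.Pairwise (· ≤ ·)) {a b : ℝ} (ha : a ∈ l)
    (hb : b ∈ l) (hab : a < b) : firstKnot l < lastKnot l :=
  (firstKnot_le hl ha).trans_lt (hab.trans_le (le_lastKnot hl hb))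

/-- The nondecreasing sequence obtained from `l` by inserting the knot `t`. -/
def insertKnot (t : ℝ) (l : List ℝ) : List ℝ := l.orderedInsert (· ≤ ·) t

theorem insertKnot_pairwise (t : ℝ) {l : List ℝ} (hl : l.Pairwise (· ≤ ·)) :
    (insertKnot t l).Pairwise (· ≤ ·) := hl.orderedInsert t l

theorem mem_insertKnot {t a : ℝ} {l : List ℝ} : a ∈ insertKnot t l ↔ a = t ∨ a ∈ l :=
  List.mem_orderedInsert (r := (· ≤ ·))

theorem insertKnot_length (t : ℝ) (l : List ℝ) : (insertKnot t l).length = l.length + 1 :=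
  List.orderedInsert_length (r := (· ≤ ·)) l t

theorem insertKnot_dropLast_nondeg {t : ℝ} {l : List ℝ} (hl : l.Pairwise (· ≤ ·))
    (h1 : firstKnot l < t) (h2 : t < lastKnot l) :
    firstKnot (insertKnot t l).dropLast < lastKnot (insertKnot t l).dropLast := by
  have hne : l ≠ [] := by rintro rfl; simp [firstKnot, lastKnot] at h1 h2; linarith
  have hs := insertKnot_pairwise t hl
  have hne' : insertKnot t l ≠ [] := List.ne_nil_of_mem (mem_insertKnot.2 (Or.inl rfl))
  have hlast : lastKnot l ≤ (insertKnot t l).getLast hne' := by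
    rw [← lastKnot_eq]; exact le_lastKnot hs (mem_insertKnot.2 (Or.inr (lastKnot_mem hne)))
  have key : ∀ a ∈ insertKnot t l, a < lastKnot l → a ∈ (insertKnot t l).dropLast := by
    intro a ha hlt
    rw [← List.dropLast_append_getLast hne'] at ha
    rcases List.mem_append.1 ha with h | h
    · exact h
    · have := List.mem_singleton.1 h; linarith
  exact firstKnot_lt_lastKnot (hs.sublist (List.dropLast_sublist _))
    (key _ (mem_insertKnot.2 (Or.inr (firstKnot_mem hne))) (h1.trans h2))
    (key _ (mem_insertKnot.2 (Or.inl rfl)) h2) h1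

theorem insertKnot_tail_nondeg {t : ℝ} {l : List ℝ} (hl : l.Pairwise (· ≤ ·))
    (h1 : firstKnot l < t) (h2 : t < lastKnot l) :
    firstKnot (insertKnot t l).tail < lastKnot (insertKnot t l).tail := by
  have hne : l ≠ [] := by rintro rfl; simp [firstKnot, lastKnot] at h1 h2; linarith
  have hs := insertKnot_pairwise t hl
  have key : ∀ a ∈ insertKnot t l, firstKnot l < a → a ∈ (insertKnot t l).tail := by
    intro a ha hlt
    have hf := firstKnot_le hs (mem_insertKnot.2 (Or.inr (firstKnot_mem hne)))
    revert ha hf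
    cases insertKnot t l with
    | nil => simp
    | cons b m =>
      intro ha hf
      rcases List.mem_cons.1 ha with h | h
      · simp [firstKnot] at hf hlt; linarith
      · exact h
  exact firstKnot_lt_lastKnot (hs.sublist (List.tail_sublist _))
    (key _ (mem_insertKnot.2 (Or.inl rfl)) h1)
    (key _ (mem_insertKnot.2 (Or.inr (lastKnot_mem hne))) (h1.trans h2)) h2

namespace BSpline

variable {p : Fin 2 → ℕ}

/-- Replace the knot vector of direction `k`. -/
def replace (B : BSpline p) (k : Fin 2) (l : List ℝ) (h1 : l.Pairwise (· ≤ ·))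
    (h2 : l.length = p k + 2) (h3 : firstKnot l < lastKnot l) : BSpline p where
  knots := Function.update B.knots k l
  sorted := by
    intro i; by_cases h : i = k
    · subst h; simpa using h1
    · simpa [h] using B.sorted i
  length_eq := by
    intro i; by_cases h : i = k
    · subst h; simpa using h2
    · simpa [h] using B.length_eq i
  nondeg := by
    intro i; by_cases h : i = k
    · subst h; simpa using h3
    · simpa [h] using B.nondeg i

/-- First B-spline of the knot insertion of `t` in direction `k`: the first `p k + 2` knots. -/
def insertFirst (B : BSpline p) (k : Fin 2) (t : ℝ) (h1 : B.supp.lo k < t)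
    (h2 : t < B.supp.hi k) : BSpline p :=
  B.replace k (insertKnot t (B.knots k)).dropLast
    ((insertKnot_pairwise t (B.sorted k)).sublist (List.dropLast_sublist _))
    (by simp [insertKnot_length, B.length_eq k])
    (insertKnot_dropLast_nondeg (B.sorted k) h1 h2)

/-- Second B-spline of the knot insertion of `t` in direction `k`: the last `p k + 2` knots. -/
def insertLast (B : BSpline p) (k : Fin 2) (t : ℝ) (h1 : B.supp.lo k < t)
    (h2 : t < B.supp.hi k) : BSpline p :=
  B.replace k (insertKnot t (B.knots k)).tail
    ((insertKnot_pairwise t (B.sorted k)).sublist (List.tail_sublist _))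
    (by simp [insertKnot_length, B.length_eq k])
    (insertKnot_tail_nondeg (B.sorted k) h1 h2)

end BSpline

/-- One pass of the refinement loop on the mesh `M`: a B-spline of the current collection that has no
minimal support is replaced by the two B-splines obtained by inserting a knot `t`, where `t` comes
from a split of `M` that traverses the support of `B` with larger multiplicity than `t` has in `B`. -/
def RefineStep {p : Fin 2 → ℕ} (M : Mesh) (S S' : Set (BSpline p)) : Prop :=
  ∃ B ∈ S, ¬ B.HasMinimalSupport M ∧
    ∃ (k : Fin 2) (t : ℝ) (h1 : B.supp.lo k < t) (h2 : t < B.supp.hi k),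
      (∀ s ∈ Set.Ico (B.supp.lo (1 - k)) (B.supp.hi (1 - k)),
        (B.knots k).count t < M.multAbove k t s) ∧
      S' = (S \ {B}) ∪ {B.insertFirst k t h1 h2, B.insertLast k t h1 h2}

/-- The tensor product B-splines on consecutive knots of the initial knot vectors. -/
def tensorBSplines (p : Fin 2 → ℕ) (T : Fin 2 → List ℝ) : Set (BSpline p) :=
  {B | ∀ k, B.knots k <:+: T k}

/-- `S` is a collection of LR B-splines of bidegree `p` on `M`: it is produced by the LR B-spline
algorithm along some construction of `M` as an LR-mesh (after each insertion the refinement loop is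
run, in any order, until all B-splines have minimal support). -/
inductive IsLRCollection (p : Fin 2 → ℕ) : Mesh → Set (BSpline p) → Prop
  | tensor (T : Fin 2 → List ℝ) (hT : IsInitial p T) :
      IsLRCollection p (tensorMesh T) (tensorBSplines p T)
  | insert (M : Mesh) (γ : Split) (S S' : Set (BSpline p)) (hM : IsLRCollection p M S)
      (hγ : AdmissibleInsertion p M γ)
      (hrun : Relation.ReflTransGen (RefineStep (M.insert γ)) S S')
      (hfinal : ∀ B ∈ S', B.HasMinimalSupport (M.insert γ)) :
      IsLRCollection p (M.insert γ) S'

/-- `B` is an LR B-spline on `M` (for some construction of `M`). -/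
def IsLRBSpline {p : Fin 2 → ℕ} (M : Mesh) (B : BSpline p) : Prop :=
  ∃ S, IsLRCollection p M S ∧ B ∈ S

/-- `C 0, …, C 5` are labelled as follows: the support of `C 0` is the union of all six supports, and
`C 1, C 2, C 3, C 4` are nested into `C 0` at its lower left, upper left, upper right and lower right
vertex, respectively.  So `C 5` is the sixth B-spline. -/
def IsLabelling {p : Fin 2 → ℕ} (C : Fin 6 → BSpline p) : Prop :=
  (C 0).supp.toSet = ⋃ j, (C j).supp.toSet ∧
  (C 1).IsNestedAt ![(C 0).supp.lo 0, (C 0).supp.lo 1] (C 0) ∧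
  (C 2).IsNestedAt ![(C 0).supp.lo 0, (C 0).supp.hi 1] (C 0) ∧
  (C 3).IsNestedAt ![(C 0).supp.hi 0, (C 0).supp.hi 1] (C 0) ∧
  (C 4).IsNestedAt ![(C 0).supp.hi 0, (C 0).supp.lo 1] (C 0)

end LRSpline

end

open Polynomial MeasureTheory

namespace LRSpline

/-! A univariate B-spline is, up to a nonzero factor, the Peano kernel of the divided difference at
its knots. Integrating the linear relation against products of derivatives of polynomials turns it
into a relation between products of divided differences, `exists_sum_dd_eq_zero`. Suitable test
polynomials then show that every pair of knots of one B-spline occurs, with at least the same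
multiplicities, in another one (`Dependent.cov`).

Applied at extremal corners, this gives at each of the four corners a smaller B-spline sharing the
corner with a larger one. The smaller one has knots in excess of the larger one, and these must be
covered by a third B-spline, which minimality of the larger one keeps away from its two far sides.
Since there are only six B-splines, the larger ones coincide in a single `e`, the third ones in a
single `f`, and `f` lies in the interior of the support of `e`: a `Pinwheel`. This is the labelling.

On one side of `e`, only `e` and the two B-splines at the ends of that side survive a test
polynomial. The resulting three-term relation, by an argument with Rolle's theorem, allows the two
small ones together just one knot `u` beyond those of `e` (`Pinwheel.exists_le_cons`). Consequently
the knots of `f` in each direction are those of `e` with one copy of each end knot replaced by such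
a `u`.

For the last claim call `g` trapped if its support contains that of `f` and lies strictly inside
that of `e` in one direction. If `g` has support on the mesh, it is then strictly inside in both
directions, by counting knots (`Pinwheel.pos_lt_of_pos_lt`). No tensor product B-spline of the
initial mesh is trapped. A knot insertion changes one direction only, so a trapped result was
already trapped before the insertion, through the other direction. Hence the algorithm never
produces a trapped B-spline, and `f` is trapped. -/

/-! ### Divided differences of polynomials -/

/-- The monic polynomial with the given roots. -/
noncomputable def knotPoly (s : Multiset ℝ) : ℝ[X] := (s.map fun a => X - C a).prod

theorem knotPoly_monic (s : Multiset ℝ) : (knotPoly s).Monic :=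
  monic_multiset_prod_of_monic _ _ fun a _ => monic_X_sub_C a

theorem knotPoly_natDegree (s : Multiset ℝ) : (knotPoly s).natDegree = s.card :=
  natDegree_multiset_prod_X_sub_C_eq_card s

theorem knotPoly_cons (a : ℝ) (s : Multiset ℝ) : knotPoly (a ::ₘ s) = (X - C a) * knotPoly s := by
  simp [knotPoly]

theorem knotPoly_add (s t : Multiset ℝ) : knotPoly (s + t) = knotPoly s * knotPoly t := by
  simp [knotPoly]

theorem knotPoly_dvd {s t : Multiset ℝ} (h : s ≤ t) : knotPoly s ∣ knotPoly t := by
  obtain ⟨r, rfl⟩ := Multiset.le_iff_exists_add.1 h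
  exact ⟨knotPoly r, knotPoly_add _ _⟩

theorem knotPoly_eval (s : Multiset ℝ) (z : ℝ) :
    (knotPoly s).eval z = (s.map fun a => z - a).prod := by
  rw [knotPoly, eval_multiset_prod, Multiset.map_map]; simp

theorem knotPoly_eval_ne_zero {s : Multiset ℝ} {z : ℝ} (h : z ∉ s) : (knotPoly s).eval z ≠ 0 := by
  rw [knotPoly_eval]
  intro h0
  obtain ⟨a, ha, h1⟩ := Multiset.mem_map.1 (Multiset.prod_eq_zero_iff.1 h0)
  exact h (by rwa [sub_eq_zero.1 h1])

/-- The divided difference of a polynomial at the points `s`: the leading coefficient of its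
interpolation polynomial. -/
noncomputable def dd (s : Multiset ℝ) : ℝ[X] →ₗ[ℝ] ℝ :=
  (lcoeff ℝ (s.card - 1)) ∘ₗ (knotPoly s).modByMonicHom

theorem dd_apply (s : Multiset ℝ) (f : ℝ[X]) :
    dd s f = (f %ₘ knotPoly s).coeff (s.card - 1) := rfl

theorem dd_eq_zero {s : Multiset ℝ} {f : ℝ[X]} (h : knotPoly s ∣ f) : dd s f = 0 := by
  rw [dd_apply, (modByMonic_eq_zero_iff_dvd (knotPoly_monic s)).2 h, coeff_zero]

theorem dd_singleton (a : ℝ) (f : ℝ[X]) : dd {a} f = f.eval a := by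
  simp [dd_apply, knotPoly, modByMonic_X_sub_C_eq_C_eval]

theorem natDegree_modByMonic_knotPoly_lt {s : Multiset ℝ} (hs : 0 < s.card) (f : ℝ[X]) :
    (f %ₘ knotPoly s).natDegree < s.card := by
  rw [← knotPoly_natDegree s]
  refine natDegree_modByMonic_lt f (knotPoly_monic s) fun h => ?_
  have := knotPoly_natDegree s
  rw [h, natDegree_one] at this; omega

/-- Multiplying dividend and divisor by `X - C a` multiplies the remainder by `X - C a`, which
shifts its top coefficient up by one place. -/
theorem dd_cons_mul (a : ℝ) (s : Multiset ℝ) (f : ℝ[X]) :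
    dd (a ::ₘ s) ((X - C a) * f) = dd s f := by
  -- For empty `s` the truncated index `s.card - 1` is `0`; remainders modulo `1` vanish, so both
  -- sides are zero.
  rcases Nat.eq_zero_or_pos s.card with h0 | hs
  · rw [Multiset.card_eq_zero.1 h0]
    simp [dd_apply, knotPoly, modByMonic_X_sub_C_eq_C_eval]
  · have hm : ((X - C a) * f) %ₘ knotPoly (a ::ₘ s) = (X - C a) * (f %ₘ knotPoly s) := by
      refine (div_modByMonic_unique (f /ₘ knotPoly s) _ (knotPoly_monic _) ⟨?_, ?_⟩).2
      · rw [knotPoly_cons, mul_assoc, ← mul_add, add_comm, add_comm, modByMonic_add_div]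
      · rw [knotPoly_cons, degree_mul, degree_mul]
        have h1 := degree_modByMonic_lt f (knotPoly_monic s)
        rw [degree_X_sub_C]
        exact WithBot.add_lt_add_left (by simp) h1
    obtain ⟨n, hn⟩ : ∃ n, s.card = n + 1 := ⟨s.card - 1, by omega⟩
    have h2 := natDegree_modByMonic_knotPoly_lt hs f
    rw [dd_apply, dd_apply, hm, Multiset.card_cons, hn]
    have h3 : (f %ₘ knotPoly s).coeff (n + 1) = 0 := coeff_eq_zero_of_natDegree_lt (by omega)
    simp [sub_mul, coeff_X_mul, h3]

theorem dd_add_mul (t s : Multiset ℝ) (f : ℝ[X]) : dd (t + s) (knotPoly t * f) = dd s f := by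
  induction t using Multiset.induction_on generalizing f with
  | empty => simp [knotPoly]
  | cons a t ih => rw [Multiset.cons_add, knotPoly_cons, mul_assoc, dd_cons_mul, ih]

/-- Both terms become divided differences at `a ::ₘ b ::ₘ s`, and `(X - a) f - (X - b) f = (b - a)
f`. No division occurs, so `a = b` is allowed. -/
theorem dd_sub (a b : ℝ) (s : Multiset ℝ) (f : ℝ[X]) :
    dd (b ::ₘ s) f - dd (a ::ₘ s) f = (b - a) * dd (a ::ₘ b ::ₘ s) f := by
  rw [← dd_cons_mul a (b ::ₘ s) f, ← dd_cons_mul b (a ::ₘ s) f, Multiset.cons_swap b a s, ← map_sub,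
    ← smul_eq_mul (b - a), ← map_smul (dd _) (b - a)]
  congr 1
  rw [smul_eq_C_mul, C_sub]; ring

theorem dd_C {s : Multiset ℝ} (hs : 2 ≤ s.card) (c : ℝ) : dd s (C c) = 0 := by
  have : (C c : ℝ[X]) %ₘ knotPoly s = C c := by
    rw [modByMonic_eq_self_iff (knotPoly_monic s)]
    refine degree_lt_degree ?_
    rw [natDegree_C, knotPoly_natDegree]; omega
  rw [dd_apply, this, coeff_C, if_neg (by omega)]

theorem exists_eq_X_sub_C_mul_add_C (a : ℝ) (f : ℝ[X]) : ∃ q c, f = (X - C a) * q + C c :=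
  ⟨f /ₘ (X - C a), f.eval a, by
    rw [← modByMonic_X_sub_C_eq_C_eval, add_comm, modByMonic_add_div]⟩

/-- The confluent case, needed where the Cox-de Boor recursion divides by zero. Splitting off `X - C
a` lowers the number of copies by one. -/
theorem dd_replicate_derivative (a : ℝ) (n : ℕ) (f : ℝ[X]) :
    dd (Multiset.replicate (n + 1) a) (derivative f)
      = (n + 1) * dd (Multiset.replicate (n + 2) a) f := by
  obtain ⟨q, c, rfl⟩ := exists_eq_X_sub_C_mul_add_C a f
  induction n generalizing q c with
  | zero => 
    rw [map_add (dd (Multiset.replicate (0+2) a)), dd_C (by simp), Multiset.replicate_succ a (0 + 1),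
      dd_cons_mul]
    simp [dd_singleton]
  | succ n ih =>
    obtain ⟨q', c', hq⟩ := exists_eq_X_sub_C_mul_add_C a q
    have ih' := ih q' c'
    rw [← hq] at ih'
    rw [map_add (dd (Multiset.replicate (n + 1 + 2) a)), dd_C (by simp),
      Multiset.replicate_succ a (n + 1 + 1), dd_cons_mul]
    rw [derivative_add, derivative_C, add_zero, derivative_mul, map_add,
      Multiset.replicate_succ a (n + 1), dd_cons_mul, ih', ← Multiset.replicate_succ]
    simp
    ring

/-! ### B-splines as Peano kernels -/

/-- The knots `t i, …, t (i + n - 1)`. -/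
noncomputable def seg (t : ℕ → ℝ) (i n : ℕ) : Multiset ℝ := (Multiset.range n).map fun j => t (i + j)

theorem seg_succ_last (t : ℕ → ℝ) (i n : ℕ) : seg t i (n + 1) = t (i + n) ::ₘ seg t i n := by
  simp [seg, Multiset.range_succ]

theorem seg_succ_first (t : ℕ → ℝ) (i n : ℕ) : seg t i (n + 1) = t i ::ₘ seg t (i + 1) n := by
  induction n with
  | zero => simp [seg]
  | succ n ih =>
    rw [seg_succ_last, ih, seg_succ_last t (i + 1), Multiset.cons_swap]
    congr 3; ring

theorem seg_eq_replicate {t : ℕ → ℝ} {i n : ℕ} {a : ℝ} (h : ∀ j < n, t (i + j) = a) :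
    seg t i n = Multiset.replicate n a := by
  rw [seg, Multiset.map_congr rfl (fun j hj => h j (Multiset.mem_range.1 hj)), Multiset.map_const',
    Multiset.card_range]

theorem integrable_coxDeBoor_mul (t : ℕ → ℝ) (d i : ℕ) (f : ℝ[X]) :
    Integrable fun z => coxDeBoor t d i z * f.eval z := by
  induction d generalizing i f with
  | zero =>
    have : (fun z => coxDeBoor t 0 i z * f.eval z)
        = Set.indicator (Set.Ico (t i) (t (i + 1))) fun z => f.eval z := by
      ext z; by_cases hz : t i ≤ z ∧ z < t (i + 1) <;> simp [coxDeBoor, Set.indicator, hz]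
    rw [this, integrable_indicator_iff measurableSet_Ico]
    exact (f.continuous.integrableOn_Icc).mono_set Set.Ico_subset_Icc_self
  | succ d ih =>
    have h := (ih i ((X - C (t i)) * C (1 / (t (i + d + 1) - t i)) * f)).add
      (ih (i + 1) ((C (t (i + d + 2)) - X) * C (1 / (t (i + d + 2) - t (i + 1))) * f))
    refine h.congr (Filter.Eventually.of_forall fun z => ?_)
    simp [coxDeBoor]
    ring

theorem iterate_derivative_X_sub_C_mul_derivative (a : ℝ) (f : ℝ[X]) (n : ℕ) :
    derivative^[n] ((X - C a) * derivative f)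
      = (X - C a) * derivative^[n + 1] f + (n : ℝ[X]) * derivative^[n] f := by
  induction n with
  | zero => simp
  | succ n ih =>
    rw [Function.iterate_succ_apply', ih, Function.iterate_succ_apply' derivative (n + 1),
      Function.iterate_succ_apply' derivative n]
    simp
    ring

/-- Absorbs a linear factor of the Cox-de Boor recursion into the polynomial, so that the Peano
formula of lower degree applies. -/
theorem iterate_derivative_kernel (a : ℝ) (f : ℝ[X]) (n : ℕ) :
    derivative^[n] ((X - C a) * derivative f - (n : ℝ[X]) * f)
      = (X - C a) * derivative^[n + 1] f := by
  rw [iterate_derivative_sub, iterate_derivative_X_sub_C_mul_derivative,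
    iterate_derivative_natCast_mul]
  ring

theorem dd_kernel (a : ℝ) (s : Multiset ℝ) (f : ℝ[X]) (n : ℕ) :
    dd (a ::ₘ s) ((X - C a) * derivative f - (n : ℝ[X]) * f)
      = dd s (derivative f) - n * dd (a ::ₘ s) f := by
  rw [map_sub, dd_cons_mul, ← nsmul_eq_mul, map_nsmul, nsmul_eq_mul]

theorem eq_of_le_succ_of_eq {t : ℕ → ℝ} {i n : ℕ}
    (ht : ∀ j, i ≤ j → j < i + n → t j ≤ t (j + 1)) (h : t (i + n) = t i) :
    ∀ j ≤ n, t (i + j) = t i := by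
  have hm : ∀ j k, j + k ≤ n → t (i + j) ≤ t (i + j + k) := by
    intro j k
    induction k with
    | zero => intro _; simp
    | succ k ih =>
      intro hk
      exact (ih (by omega)).trans (ht (i + j + k) (by omega) (by omega))
  intro j hj
  apply le_antisymm
  · have := hm j (n - j) (by omega)
    rwa [show i + j + (n - j) = i + n by omega, h] at this
  · have := hm 0 j (by omega)
    simpa using this

/-- The Peano kernel formula, by induction along the Cox-de Boor recursion. Stating it with the
factor `t (i + d + 1) - t i` keeps it valid for coinciding knots. -/
theorem integral_coxDeBoor_mul (t : ℕ → ℝ) (d i : ℕ)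
    (ht : ∀ j, i ≤ j → j < i + d + 1 → t j ≤ t (j + 1)) (f : ℝ[X]) :
    ∫ z, coxDeBoor t d i z * (derivative^[d + 1] f).eval z
      = d.factorial * (t (i + d + 1) - t i) * dd (seg t i (d + 2)) f := by
  induction d generalizing i f with
  | zero =>
    have h1 : (fun z => coxDeBoor t 0 i z * (derivative^[0 + 1] f).eval z)
        = Set.indicator (Set.Ico (t i) (t (i + 1))) fun z => (derivative f).eval z := by
      ext z; by_cases hz : t i ≤ z ∧ z < t (i + 1) <;> simp [coxDeBoor, Set.indicator, hz]
    have h2 := ht i le_rfl (by omega)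
    rw [h1, integral_indicator measurableSet_Ico, integral_Ico_eq_integral_Ioc,
      ← intervalIntegral.integral_of_le h2,
      intervalIntegral.integral_eq_sub_of_hasDerivAt (fun z _ => f.hasDerivAt z)
        ((derivative f).continuous.intervalIntegrable _ _)]
    have h3 := dd_sub (t i) (t (i + 1)) 0 f
    simp only [Multiset.cons_zero, dd_singleton] at h3
    have h4 : seg t i (0 + 2) = t i ::ₘ {t (i + 1)} := by
      rw [seg_succ_first, seg_succ_first]; simp [seg]
    rw [h3, h4]
    simp
  | succ d ih =>
    set Z := seg t (i + 1) (d + 1)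
    have e0 : seg t i (d + 2) = t i ::ₘ Z := seg_succ_first _ _ _
    have e1 : seg t (i + 1) (d + 2) = t (i + d + 2) ::ₘ Z := by
      rw [seg_succ_last]; congr 2; ring
    have e2 : seg t i (d + 1 + 2) = t i ::ₘ t (i + d + 2) ::ₘ Z := by rw [seg_succ_first, e1]
    set g0 := (X - C (t i)) * derivative f - ((d + 1 : ℕ) : ℝ[X]) * f with hg0
    set g1 := (X - C (t (i + d + 2))) * derivative f - ((d + 1 : ℕ) : ℝ[X]) * f with hg1
    have k0 : dd (seg t i (d + 2)) g0 = dd Z (derivative f) - (d + 1 : ℕ) * dd (t i ::ₘ Z) f := by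
      rw [e0, hg0, dd_kernel]
    have k1 : dd (seg t (i + 1) (d + 2)) g1
        = dd Z (derivative f) - (d + 1 : ℕ) * dd (t (i + d + 2) ::ₘ Z) f := by
      rw [e1, hg1, dd_kernel]
    -- The denominators cancel. If all knots coincide, the left side is zero by `1 / 0 = 0`, and so
    -- is the right side by `dd_replicate_derivative`.
    have aux : ∀ (k : ℕ) (a : ℝ), (∀ j, k ≤ j → j < k + d + 1 → t j ≤ t (j + 1)) →
        (t (k + d + 1) = t k → a = t k) →
        1 / (t (k + d + 1) - t k) * (d.factorial * (t (k + d + 1) - t k) *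
          dd (seg t k (d + 2)) ((X - C a) * derivative f - ((d + 1 : ℕ) : ℝ[X]) * f))
          = d.factorial * dd (seg t k (d + 2))
            ((X - C a) * derivative f - ((d + 1 : ℕ) : ℝ[X]) * f) := by
      intro k a hk ha
      by_cases h : t (k + d + 1) = t k
      · have hr := eq_of_le_succ_of_eq (n := d + 1) hk h
        rw [ha h, seg_eq_replicate (a := t k) (fun j hj => hr j (by omega)),
          Multiset.replicate_succ, dd_kernel, dd_replicate_derivative, ← Multiset.replicate_succ]
        push_cast; simp
      · field_simp [sub_ne_zero.2 h]
    have hI : ∀ z, coxDeBoor t (d + 1) i z * (derivative^[d + 1 + 1] f).eval z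
        = 1 / (t (i + d + 1) - t i) * (coxDeBoor t d i z * (derivative^[d + 1] g0).eval z)
          - 1 / (t (i + 1 + d + 1) - t (i + 1)) *
            (coxDeBoor t d (i + 1) z * (derivative^[d + 1] g1).eval z) := by
      intro z
      rw [hg0, hg1, iterate_derivative_kernel, iterate_derivative_kernel,
        show i + 1 + d + 1 = i + d + 2 by ring]
      simp [coxDeBoor]
      ring
    simp_rw [hI]
    rw [integral_sub ((integrable_coxDeBoor_mul t d i _).const_mul _)
      ((integrable_coxDeBoor_mul t d (i + 1) _).const_mul _), integral_const_mul,
      integral_const_mul, ih i (fun j h1 h2 => ht j h1 (by omega)),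
      ih (i + 1) (fun j h1 h2 => ht j (by omega) (by omega)),
      aux i (t i) (fun j h1 h2 => ht j h1 (by omega)) (fun _ => rfl),
      aux (i + 1) (t (i + d + 2)) (fun j h1 h2 => ht j (by omega) (by omega))
        (fun h => by rw [← h]; congr 1; ring), k0, k1, e2]
    -- The two terms `dd Z (derivative f)` cancel, and `dd_sub` evaluates what remains.
    have h3 := dd_sub (t i) (t (i + d + 2)) Z f
    have h4 : i + (d + 1) + 1 = i + d + 2 := by ring
    rw [h4, Nat.factorial_succ]
    push_cast
    linear_combination ((d + 1 : ℝ) * d.factorial) * h3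


/-! ### Knot multisets, and the passage from B-splines to divided differences -/

namespace BSpline

variable {p : Fin 2 → ℕ}

/-- The knots in direction `k`, with their multiplicities. -/
def mknots (B : BSpline p) (k : Fin 2) : Multiset ℝ := ↑(B.knots k)

theorem card_mknots (B : BSpline p) (k : Fin 2) : (B.mknots k).card = p k + 2 := by
  simp [mknots, B.length_eq]

theorem knots_ne_nil (B : BSpline p) (k : Fin 2) : B.knots k ≠ [] := by
  intro h; have := B.length_eq k; simp [h] at this

theorem lo_mem (B : BSpline p) (k : Fin 2) : B.supp.lo k ∈ B.mknots k :=
  firstKnot_mem (B.knots_ne_nil k)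

theorem hi_mem (B : BSpline p) (k : Fin 2) : B.supp.hi k ∈ B.mknots k :=
  lastKnot_mem (B.knots_ne_nil k)

theorem lo_le (B : BSpline p) {k : Fin 2} {a : ℝ} (h : a ∈ B.mknots k) : B.supp.lo k ≤ a :=
  firstKnot_le (B.sorted k) h

theorem le_hi (B : BSpline p) {k : Fin 2} {a : ℝ} (h : a ∈ B.mknots k) : a ≤ B.supp.hi k :=
  le_lastKnot (B.sorted k) h

theorem lo_lt_hi (B : BSpline p) (k : Fin 2) : B.supp.lo k < B.supp.hi k := B.nondeg k

theorem count_mknots (B : BSpline p) (k : Fin 2) (a : ℝ) :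
    (B.mknots k).count a = (B.knots k).count a := by simp [mknots]

theorem ext_mknots {B B' : BSpline p} (h : ∀ k, B.mknots k = B'.mknots k) : B = B' := by
  ext1
  funext k
  exact (Multiset.coe_eq_coe.1 (h k)).eq_of_pairwise' (B.sorted k) (B'.sorted k)

theorem seg_getD (l : List ℝ) : seg (fun i => l.getD i 0) 0 l.length = (l : Multiset ℝ) := by
  rw [seg, Multiset.range, Multiset.map_coe]
  congr 1
  refine List.ext_getElem (by simp) fun i h1 h2 => ?_
  simp [List.getElem?_eq_getElem h2]

/-- One univariate factor of `B`. -/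
noncomputable def factor (B : BSpline p) (k : Fin 2) (z : ℝ) : ℝ :=
  coxDeBoor (fun i => (B.knots k).getD i 0) (p k) 0 z

theorem eval_eq (B : BSpline p) (z : Fin 2 → ℝ) : B.eval z = B.factor 0 (z 0) * B.factor 1 (z 1) := by
  simp [eval, factor, Fin.prod_univ_two]

theorem integrable_factor_mul (B : BSpline p) (k : Fin 2) (f : ℝ[X]) :
    Integrable fun z => B.factor k z * f.eval z := integrable_coxDeBoor_mul _ _ _ _

theorem integral_factor_mul (B : BSpline p) (k : Fin 2) (f : ℝ[X]) :
    ∫ z, B.factor k z * (derivative^[p k + 1] f).eval z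
      = (p k).factorial * (B.supp.hi k - B.supp.lo k) * dd (B.mknots k) f := by
  have hl := B.length_eq k
  have hne := B.knots_ne_nil k
  have h := integral_coxDeBoor_mul (fun i => (B.knots k).getD i 0) (p k) 0 (by
    intro j _ h2
    have h3 : j + 1 < (B.knots k).length := by omega
    rw [List.getD_eq_getElem _ _ h3, List.getD_eq_getElem _ _ (by omega : j < _)]
    exact List.pairwise_iff_getElem.1 (B.sorted k) j (j + 1) (by omega) h3 (by omega)) f
  rw [← hl, seg_getD] at h
  have e0 : (B.knots k).getD 0 0 = B.supp.lo k := by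
    change _ = firstKnot _
    revert hne
    cases B.knots k <;> simp [firstKnot]
  have e1 : (B.knots k).getD (0 + p k + 1) 0 = B.supp.hi k := by
    change _ = lastKnot _
    rw [lastKnot_eq hne, List.getLast_eq_getElem, List.getD_eq_getElem _ _ (by omega)]
    congr 1; omega
  rw [e0, e1] at h
  exact h

end BSpline

/-- Integrate in `x` for fixed `y`, then in `y`. The new coefficients differ from the old ones by
factorials and side lengths of the supports, which are nonzero. -/
theorem exists_sum_dd_eq_zero {ι : Type*} [Fintype ι] {p : Fin 2 → ℕ} (B : ι → BSpline p)
    (α : ι → ℝ) (hα : ∀ j, α j ≠ 0) (hrel : ∀ z : Fin 2 → ℝ, ∑ j, α j * (B j).eval z = 0) :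
    ∃ β : ι → ℝ, (∀ j, β j ≠ 0) ∧ ∀ f g : ℝ[X],
      ∑ j, β j * dd ((B j).mknots 0) f * dd ((B j).mknots 1) g = 0 := by
  set w : ι → Fin 2 → ℝ := fun j k => (p k).factorial * ((B j).supp.hi k - (B j).supp.lo k)
  have hw : ∀ j k, w j k ≠ 0 := fun j k =>
    mul_ne_zero (by positivity) (sub_ne_zero.2 ((B j).lo_lt_hi k).ne')
  refine ⟨fun j => α j * w j 0 * w j 1, fun j => mul_ne_zero (mul_ne_zero (hα j) (hw j 0)) (hw j 1),
    fun f g => ?_⟩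
  have h1 : ∀ y, ∑ j, α j * (w j 0 * dd ((B j).mknots 0) f) * (B j).factor 1 y = 0 := by
    intro y
    have : ∀ j, α j * (w j 0 * dd ((B j).mknots 0) f) * (B j).factor 1 y
        = ∫ x, (α j * (B j).factor 1 y) * ((B j).factor 0 x * (derivative^[p 0 + 1] f).eval x) := by
      intro j
      rw [integral_const_mul, BSpline.integral_factor_mul]
      ring
    simp_rw [this]
    rw [← integral_finsetSum _ fun j _ => ((B j).integrable_factor_mul 0 _).const_mul _]
    refine (integral_congr_ae (Filter.Eventually.of_forall fun x => ?_)).trans (integral_zero' _ _)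
    have h := hrel ![x, y]
    simp only [BSpline.eval_eq, Matrix.cons_val_zero, Matrix.cons_val_one] at h
    simp only [Pi.zero_apply]
    calc _ = (∑ j, α j * ((B j).factor 0 x * (B j).factor 1 y))
          * (derivative^[p 0 + 1] f).eval x := by
            rw [Finset.sum_mul]; exact Finset.sum_congr rfl fun j _ => by ring
      _ = 0 := by rw [h, zero_mul]
  have : ∀ j, α j * w j 0 * w j 1 * dd ((B j).mknots 0) f * dd ((B j).mknots 1) g
      = ∫ y, (α j * (w j 0 * dd ((B j).mknots 0) f)) *
          ((B j).factor 1 y * (derivative^[p 1 + 1] g).eval y) := by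
    intro j
    rw [integral_const_mul, BSpline.integral_factor_mul]
    ring
  simp_rw [this]
  rw [← integral_finsetSum _ fun j _ => ((B j).integrable_factor_mul 1 _).const_mul _]
  refine (integral_congr_ae (Filter.Eventually.of_forall fun y => ?_)).trans (integral_zero' _ _)
  simp only [Pi.zero_apply]
  calc _ = (∑ j, α j * (w j 0 * dd ((B j).mknots 0) f) * (B j).factor 1 y)
        * (derivative^[p 1 + 1] g).eval y := by
          rw [Finset.sum_mul]; exact Finset.sum_congr rfl fun j _ => by ring
    _ = 0 := by rw [h1, zero_mul]

/-! ### Consequences of a linear relation between divided differences -/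

-- The test polynomial is `(X - u) ^ (m - 1)` times all knot factors away from `u`. It contains
-- every knot polynomial of multiplicity below `m` at `u`; at multiplicity `m` just one factor `X -
-- u` is missing, and the divided difference is the value at `u` of a polynomial not vanishing
-- there.
open Classical in
theorem exists_dd_lead {ι : Type*} [Finite ι] (s : ι → Multiset ℝ) (u : ℝ) {m : ℕ} (hm : 0 < m) :
    ∃ f : ℝ[X], ∀ i, ((s i).count u < m → dd (s i) f = 0) ∧
      ((s i).count u = m → dd (s i) f ≠ 0) := by
  cases nonempty_fintype ι
  set r : ι → Multiset ℝ := fun i => (s i).filter (· ≠ u)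
  have hr : ∀ i, s i = Multiset.replicate ((s i).count u) u + r i := by
    intro i
    rw [← Multiset.filter_eq']
    exact (Multiset.filter_add_not _ _).symm
  set T := ∑ i, r i
  have hT : ∀ i, r i ≤ T := fun i => Finset.single_le_sum (f := r) (fun _ _ => Multiset.zero_le _)
    (Finset.mem_univ i)
  have huT : u ∉ T := by
    simp [T, Multiset.mem_sum, r]
  refine ⟨knotPoly (Multiset.replicate (m - 1) u + T), fun i => ⟨fun h => ?_, fun h => ?_⟩⟩
  · apply dd_eq_zero
    apply knotPoly_dvd
    rw [hr i]
    exact add_le_add ((Multiset.replicate_le_replicate u).2 (by omega)) (hT i)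
  · obtain ⟨q, hq⟩ := Multiset.le_iff_exists_add.1 (hT i)
    obtain ⟨n, rfl⟩ : ∃ n, m = n + 1 := ⟨m - 1, by omega⟩
    have e1 : s i = (Multiset.replicate n u + r i) + {u} := by
      rw [hr i, h, Multiset.replicate_succ]
      simp [add_comm]
    rw [hq, add_tsub_cancel_right, ← add_assoc, knotPoly_add, e1, dd_add_mul, dd_singleton]
    apply knotPoly_eval_ne_zero
    intro hu
    exact huT (by rw [hq]; exact Multiset.mem_add.2 (Or.inr hu))

/-- Otherwise the two test polynomials for the multiplicities of `u` and `v` in the index `i`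
annihilate every term but the `i`-th. -/
theorem exists_ne_count_le {ι : Type*} [Fintype ι] {s t : ι → Multiset ℝ} {β : ι → ℝ}
    (hβ : ∀ j, β j ≠ 0) (hrel : ∀ f g : ℝ[X], ∑ j, β j * dd (s j) f * dd (t j) g = 0)
    (i : ι) {u v : ℝ} (hu : u ∈ s i) (hv : v ∈ t i) :
    ∃ j, j ≠ i ∧ (s i).count u ≤ (s j).count u ∧ (t i).count v ≤ (t j).count v := by
  by_contra! hcon
  obtain ⟨f, hf⟩ := exists_dd_lead s u (Multiset.count_pos.2 hu)
  obtain ⟨g, hg⟩ := exists_dd_lead t v (Multiset.count_pos.2 hv)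
  have h := hrel f g
  rw [Finset.sum_eq_single i] at h
  · exact mul_ne_zero (mul_ne_zero (hβ i) ((hf i).2 rfl)) ((hg i).2 rfl) h
  · intro j _ hj
    by_cases h1 : (s i).count u ≤ (s j).count u
    · rw [(hg j).1 (hcon j hj h1), mul_zero]
    · rw [(hf j).1 (not_le.1 h1)]; ring
  · simp

/-- A power of `X` raises the degree of `h` to `s.card - 1`, where the divided difference reads off
the leading coefficient. -/
theorem eq_zero_of_forall_dd {s : Multiset ℝ} {h : ℝ[X]} (hd : h.natDegree < s.card)
    (hh : ∀ f, dd s (h * f) = 0) : h = 0 := by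
  by_contra h0
  have h1 := hh (X ^ (s.card - 1 - h.natDegree))
  have h2 : (h * X ^ (s.card - 1 - h.natDegree)).natDegree = s.card - 1 := by
    rw [natDegree_mul_X_pow _ h0]; omega
  rw [dd_apply, (modByMonic_eq_self_iff (knotPoly_monic s)).2] at h1
  · replace h1 := (congrArg (coeff _) h2).trans h1
    rw [coeff_natDegree, leadingCoeff_eq_zero] at h1
    exact (mul_ne_zero h0 (pow_ne_zero _ X_ne_zero)) h1
  · apply degree_lt_degree
    rw [h2, knotPoly_natDegree]; omega

theorem dd_eq_dd_of_le {K s : Multiset ℝ} (h : s ≤ K) (f : ℝ[X]) :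
    dd s f = dd K (knotPoly (K - s) * f) := by
  conv_rhs => rw [← tsub_add_cancel_of_le h]
  rw [add_tsub_cancel_right, dd_add_mul]

theorem knotPoly_eval_pos {s : Multiset ℝ} {z : ℝ} (h : ∀ a ∈ s, a < z) :
    0 < (knotPoly s).eval z ∧ 0 ≤ (derivative (knotPoly s)).eval z ∧
      (s ≠ 0 → 0 < (derivative (knotPoly s)).eval z) := by
  induction s using Multiset.induction_on with
  | empty => simp [knotPoly]
  | cons a s ih =>
    obtain ⟨h1, h2, -⟩ := ih fun b hb => h b (Multiset.mem_cons_of_mem hb)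
    have ha := sub_pos.2 (h a (Multiset.mem_cons_self a s))
    have h3 : 0 < (derivative (knotPoly (a ::ₘ s))).eval z := by
      simp only [knotPoly_cons, derivative_mul, derivative_sub, derivative_X, derivative_C,
        sub_zero, one_mul, eval_add, eval_mul, eval_sub, eval_X, eval_C]
      positivity
    refine ⟨?_, h3.le, fun _ => h3⟩
    rw [knotPoly_cons, eval_mul, eval_sub, eval_X, eval_C]
    positivity

theorem knotPoly_eval_of_lt {s : Multiset ℝ} {z : ℝ} (h : ∀ a ∈ s, z < a) :
    0 < (-1) ^ s.card * (knotPoly s).eval z ∧ (-1) ^ s.card * (derivative (knotPoly s)).eval z ≤ 0 ∧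
      (s ≠ 0 → (-1) ^ s.card * (derivative (knotPoly s)).eval z < 0) := by
  induction s using Multiset.induction_on with
  | empty => simp [knotPoly]
  | cons a s ih =>
    obtain ⟨h1, h2, -⟩ := ih fun b hb => h b (Multiset.mem_cons_of_mem hb)
    have ha := sub_pos.2 (h a (Multiset.mem_cons_self a s))
    have h3 : (-1) ^ (a ::ₘ s).card * (derivative (knotPoly (a ::ₘ s))).eval z < 0 := by
      simp only [knotPoly_cons, derivative_mul, derivative_sub, derivative_X, derivative_C,
        sub_zero, one_mul, eval_add, eval_mul, eval_sub, eval_X, eval_C, Multiset.card_cons, pow_succ]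
      nlinarith
    refine ⟨?_, h3.le, fun _ => h3⟩
    rw [knotPoly_cons, eval_mul, eval_sub, eval_X, eval_C, Multiset.card_cons, pow_succ]
    nlinarith

/-- A combination of two monic polynomials, one with all its roots to the left of `u₁` and the other
with all its roots to the right of `u₂`, does not vanish at both `u₁` and `u₂`. -/
theorem not_X_sub_C_mul_dvd {A D : Multiset ℝ} {a d u₁ u₂ : ℝ} (ha : a ≠ 0) (hd : d ≠ 0)
    (hu : u₁ ≤ u₂) (hA : ∀ x ∈ A, x < u₁) (hD : ∀ x ∈ D, u₂ < x) (hA0 : A ≠ 0) (hD0 : D ≠ 0) :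
    ¬ (X - C u₁) * (X - C u₂) ∣ C a * knotPoly A + C d * knotPoly D := by
  rintro ⟨q, hq⟩
  set G := C a * knotPoly A + C d * knotPoly D with hG
  have h1 : G.eval u₁ = 0 := by rw [hq]; simp
  have h2 : G.eval u₂ = 0 := by rw [hq]; simp
  -- Rolle's theorem, or a double root if `u₁ = u₂`.
  obtain ⟨z, hz1, hz2, hz⟩ : ∃ z, u₁ ≤ z ∧ z ≤ u₂ ∧ (derivative G).eval z = 0 := by
    rcases hu.eq_or_lt with rfl | hlt
    · exact ⟨u₁, le_rfl, le_rfl, by rw [hq]; simp⟩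
    · obtain ⟨z, hz, h⟩ := exists_hasDerivAt_eq_zero hlt G.continuous.continuousOn
        (h1.trans h2.symm) fun z _ => G.hasDerivAt z
      exact ⟨z, hz.1.le, hz.2.le, h⟩
  obtain ⟨p1, -, -⟩ := knotPoly_eval_pos hA
  obtain ⟨p2, -, -⟩ := knotPoly_eval_of_lt (z := u₁) fun x hx => hu.trans_lt (hD x hx)
  obtain ⟨-, -, p3⟩ := knotPoly_eval_pos (z := z) fun x hx => (hA x hx).trans_le hz1
  obtain ⟨-, -, p4⟩ := knotPoly_eval_of_lt (z := z) fun x hx => hz2.trans_lt (hD x hx)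
  replace p3 := p3 hA0
  replace p4 := p4 hD0
  simp only [hG, eval_add, eval_mul, eval_C, derivative_add, derivative_mul, derivative_C, zero_mul,
    zero_add] at h1 hz
  have hs : ((-1 : ℝ) ^ D.card) * (-1) ^ D.card = 1 := by rw [← mul_pow]; simp
  set e : ℝ := (-1) ^ D.card
  set P := (knotPoly A).eval u₁
  set Q := (knotPoly D).eval u₁
  set P' := (derivative (knotPoly A)).eval z
  set Q' := (derivative (knotPoly D)).eval z
  -- The zero at `u₁` forces `a * d * e < 0`, whereas the zero of the derivative at `z` forces the
  -- opposite sign.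
  have k1 : (a * (d * e)) * P = - ((d * e) ^ 2 * (e * Q)) := by
    linear_combination (d * e) * h1 + d ^ 2 * e * Q * hs
  have k2 : a ^ 2 * P' = - ((a * (d * e)) * (e * Q')) := by
    linear_combination a * hz + a * d * Q' * hs
  have he : e ≠ 0 := fun h => by rw [h] at hs; simp at hs
  have k3 : 0 < (d * e) ^ 2 * (e * Q) := by positivity
  have k4 : a * (d * e) < 0 := by
    by_contra h
    have := mul_nonneg (not_lt.1 h) p1.le
    linarith
  have k5 : 0 < a ^ 2 * P' := by positivity
  have := mul_pos_of_neg_of_neg k4 p4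
  linarith

/-- Let `K` be the union of the three multisets. If `K - E` had two elements, they would lie between
`K - R` on their left and `K - L` on their right, and the relation would make a combination of the
knot polynomials of the latter two vanish at both, against `not_X_sub_C_mul_dvd`. -/
theorem exists_le_cons_of_three_term {n : ℕ} {E L R : Multiset ℝ} (hE : E.card = n) (hL : L.card = n)
    (hR : R.card = n) {a b c : ℝ} (hb : b ≠ 0) (hc : c ≠ 0)
    (hrel : ∀ f, a * dd E f + b * dd L f + c * dd R f = 0)
    {l r : ℝ} (hr : ∀ x ∈ L, x ≤ r) (hl : ∀ x ∈ R, l ≤ x)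
    (hEL : ∀ x < r, E.count x ≤ L.count x) (hER : ∀ x, l < x → E.count x ≤ R.count x)
    (c1 : ∀ x ∈ E, E.count x ≤ L.count x ∨ E.count x ≤ R.count x)
    (c2 : ∀ x ∈ L, L.count x ≤ E.count x ∨ L.count x ≤ R.count x)
    (c3 : ∀ x ∈ R, R.count x ≤ E.count x ∨ R.count x ≤ L.count x) :
    ∃ u, L ≤ u ::ₘ E ∧ R ≤ u ::ₘ E := by
  have c1' : ∀ x, E.count x ≤ L.count x ∨ E.count x ≤ R.count x := fun x => by
    by_cases h : x ∈ E
    · exact c1 x h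
    · simp [Multiset.count_eq_zero.2 h]
  have c2' : ∀ x, L.count x ≤ E.count x ∨ L.count x ≤ R.count x := fun x => by
    by_cases h : x ∈ L
    · exact c2 x h
    · simp [Multiset.count_eq_zero.2 h]
  have c3' : ∀ x, R.count x ≤ E.count x ∨ R.count x ≤ L.count x := fun x => by
    by_cases h : x ∈ R
    · exact c3 x h
    · simp [Multiset.count_eq_zero.2 h]
  set K := E ∪ L ∪ R with hK
  have hcK : ∀ x, K.count x = max (max (E.count x) (L.count x)) (R.count x) := fun x => by
    simp [hK, Multiset.count_union]
  have hEK : E ≤ K := Multiset.le_union_left.trans Multiset.le_union_left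
  have hLK : L ≤ K := Multiset.le_union_right.trans Multiset.le_union_left
  have hRK : R ≤ K := Multiset.le_union_right
  by_cases hcard : (K - E).card ≤ 1
  · obtain ⟨u, hu⟩ : ∃ u : ℝ, K - E ≤ {u} := by
      rcases Nat.le_one_iff_eq_zero_or_eq_one.1 hcard with h | h
      · exact ⟨0, by rw [Multiset.card_eq_zero.1 h]; exact Multiset.zero_le _⟩
      · obtain ⟨u, hu⟩ := Multiset.card_eq_one.1 h
        exact ⟨u, hu.le⟩
    have : K ≤ u ::ₘ E := by
      rw [← Multiset.singleton_add]; exact tsub_le_iff_right.1 hu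
    exact ⟨u, hLK.trans this, hRK.trans this⟩
  exfalso
  -- By `c1`, `c2`, `c3` the largest multiplicity of a knot is attained at least twice among the
  -- three, so a multiset that misses it is the only one.
  have hcE : ∀ x ∈ K - E, L.count x = K.count x ∧ R.count x = K.count x ∧ E.count x < K.count x := by
    intro x hx
    have h := Multiset.count_pos.2 hx
    rw [Multiset.count_sub] at h
    have := hcK x
    have := c1' x; have := c2' x; have := c3' x
    omega
  have hcL : ∀ x ∈ K - L, E.count x = K.count x ∧ R.count x = K.count x ∧ L.count x < K.count x := by
    intro x hx
    have h := Multiset.count_pos.2 hx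
    rw [Multiset.count_sub] at h
    have := hcK x
    have := c1' x; have := c2' x; have := c3' x
    omega
  have hcR : ∀ x ∈ K - R, E.count x = K.count x ∧ L.count x = K.count x ∧ R.count x < K.count x := by
    intro x hx
    have h := Multiset.count_pos.2 hx
    rw [Multiset.count_sub] at h
    have := hcK x
    have := c1' x; have := c2' x; have := c3' x
    omega
  have hmid : ∀ u ∈ K - E, (∀ x ∈ K - R, x < u) ∧ ∀ x ∈ K - L, u < x := by
    intro u hu
    obtain ⟨e1, e2, e3⟩ := hcE u hu
    have h1 : l ≤ u := hl u (Multiset.count_pos.1 (by omega))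
    have h2 : u ≤ r := hr u (Multiset.count_pos.1 (by omega))
    constructor
    · intro x hx
      obtain ⟨g1, g2, g3⟩ := hcR x hx
      have h3 : x ≤ l := not_lt.1 fun h => by have := hER x h; omega
      exact lt_of_le_of_ne (h3.trans h1) (by rintro rfl; omega)
    · intro x hx
      obtain ⟨g1, g2, g3⟩ := hcL x hx
      have h3 : r ≤ x := not_lt.1 fun h => by have := hEL x h; omega
      exact lt_of_le_of_ne (h2.trans h3) (by rintro rfl; omega)
  obtain ⟨u₁, u₂, h12, hle⟩ : ∃ u₁ u₂ : ℝ, u₁ ≤ u₂ ∧ {u₁, u₂} ≤ K - E := by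
    obtain ⟨x, hx⟩ := Multiset.card_pos_iff_exists_mem.1 (by omega : 0 < (K - E).card)
    obtain ⟨t, ht⟩ := Multiset.exists_cons_of_mem hx
    rw [ht, Multiset.card_cons] at hcard
    obtain ⟨y, hy⟩ := Multiset.card_pos_iff_exists_mem.1 (by omega : 0 < t.card)
    have hs : {x, y} ≤ K - E := by
      rw [ht]; exact Multiset.cons_le_cons x (Multiset.singleton_le.2 hy)
    rcases le_total x y with h | h
    · exact ⟨x, y, h, hs⟩
    · exact ⟨y, x, h, by rwa [Multiset.pair_comm]⟩
  have cE := Multiset.card_sub hEK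
  have cL := Multiset.card_sub hLK
  have cR := Multiset.card_sub hRK
  have m1 : u₁ ∈ K - E := Multiset.mem_of_le hle (by simp)
  have m2 : u₂ ∈ K - E := Multiset.mem_of_le hle (by simp)
  have hpos : 0 < n := by
    rw [← hL]; apply Multiset.card_pos_iff_exists_mem.2
    exact ⟨u₁, Multiset.count_pos.1 (by have := hcE u₁ m1; omega)⟩
  -- All three divided differences are rewritten over `K`; the combination has degree at most
  -- `K.card - n < K.card`.
  have hpoly : C a * knotPoly (K - E) + C b * knotPoly (K - L) + C c * knotPoly (K - R) = 0 := by
    apply eq_zero_of_forall_dd (s := K)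
    · have hb : ∀ (w : ℝ) (s : Multiset ℝ), (C w * knotPoly s).natDegree ≤ s.card := fun w s =>
        (natDegree_C_mul_le _ _).trans (knotPoly_natDegree s).le
      have h1 := natDegree_add_le_of_degree_le (n := K.card - n)
        (natDegree_add_le_of_degree_le (n := K.card - n) ((hb a (K - E)).trans (by omega))
        ((hb b (K - L)).trans (by omega))) ((hb c (K - R)).trans (by omega))
      have := Multiset.card_le_card hEK
      omega
    · intro f
      rw [← hrel f, dd_eq_dd_of_le hEK, dd_eq_dd_of_le hLK, dd_eq_dd_of_le hRK]
      simp only [add_mul, map_add, ← smul_eq_C_mul, smul_mul_assoc, map_smul, smul_eq_mul]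

  refine not_X_sub_C_mul_dvd (A := K - R) (D := K - L) hc hb h12 (hmid u₁ m1).1
    (hmid u₂ m2).2 ?_ ?_ ?_
  · rw [← Multiset.card_pos]; omega
  · rw [← Multiset.card_pos]; omega
  · have h1 : (X - C u₁) * (X - C u₂) = knotPoly {u₁, u₂} := by simp [knotPoly]
    have h2 : C c * knotPoly (K - R) + C b * knotPoly (K - L) = knotPoly (K - E) * (- C a) := by
      linear_combination hpoly
    rw [h1, h2]
    exact (knotPoly_dvd hle).mul_right _


/-! ### Minimal support and the comparison of supports -/

/-- The segment of direction `k` at position `a` from `l` to `h` has multiplicity at least `m`. -/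
def Mesh.Carries (M : Mesh) (k : Fin 2) (a : ℝ) (m : ℕ) (l h : ℝ) : Prop :=
  ∀ s ∈ Set.Ico l h, m ≤ M.multAbove k a s

theorem Mesh.Carries.mono {M : Mesh} {k : Fin 2} {a : ℝ} {m m' : ℕ} {l h l' h' : ℝ}
    (H : M.Carries k a m l h) (hm : m' ≤ m) (hl : l ≤ l') (hh : h' ≤ h) :
    M.Carries k a m' l' h' :=
  fun s hs => hm.trans (H s ⟨hl.trans hs.1, hs.2.trans_le hh⟩)

theorem Mesh.Carries.union {M : Mesh} {k : Fin 2} {a : ℝ} {m : ℕ} {l h l' h' v : ℝ}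
    (H : M.Carries k a m l h) (H' : M.Carries k a m l' h') (hv : v ∈ Set.Icc l h)
    (hv' : v ∈ Set.Icc l' h') : M.Carries k a m (min l l') (max h h') := by
  intro s ⟨h1, h2⟩
  rcases min_le_iff.1 h1 with h3 | h3 <;> rcases lt_max_iff.1 h2 with h4 | h4
  · exact H s ⟨h3, h4⟩
  · by_cases h5 : s < h
    · exact H s ⟨h3, h5⟩
    · exact H' s ⟨hv'.1.trans (hv.2.trans (not_lt.1 h5)), h4⟩
  · by_cases h5 : s < h'
    · exact H' s ⟨h3, h5⟩
    · exact H s ⟨hv.1.trans (hv'.2.trans (not_lt.1 h5)), h4⟩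
  · exact H' s ⟨h3, h4⟩

namespace BSpline

variable {p : Fin 2 → ℕ}

/-- The endpoint of the support in direction `k` on the given side (`false` for the lower one). -/
def endpt (B : BSpline p) (k : Fin 2) (ε : Bool) : ℝ := cond ε (B.supp.hi k) (B.supp.lo k)

/-- How far the support extends in direction `k` on the given side. -/
noncomputable def pos (B : BSpline p) (k : Fin 2) (ε : Bool) : ℝ :=
  cond ε (B.supp.hi k) (-B.supp.lo k)

/-- The extent of the support together with the multiplicity of its end knot, ordered
lexicographically. -/
noncomputable def lead (B : BSpline p) (k : Fin 2) (ε : Bool) : ℝ ×ₗ ℕ :=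
  toLex (B.pos k ε, (B.mknots k).count (B.endpt k ε))

/-- The coordinate `a` lies strictly inside the support in direction `k`. -/
def Inside (B : BSpline p) (k : Fin 2) (a : ℝ) : Prop := B.supp.lo k < a ∧ a < B.supp.hi k

theorem endpt_mem (B : BSpline p) (k : Fin 2) (ε : Bool) : B.endpt k ε ∈ B.mknots k := by
  cases ε
  exacts [B.lo_mem k, B.hi_mem k]

theorem endpt_eq_of_pos_eq {B B' : BSpline p} {k : Fin 2} {ε : Bool}
    (h : B.pos k ε = B'.pos k ε) : B.endpt k ε = B'.endpt k ε := by
  cases ε <;> simpa [pos, endpt] using h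

theorem lead_eq_iff {B B' : BSpline p} {k : Fin 2} {ε : Bool} :
    B.lead k ε = B'.lead k ε ↔ B.pos k ε = B'.pos k ε ∧
      (B.mknots k).count (B.endpt k ε) = (B'.mknots k).count (B'.endpt k ε) := by
  simp [lead]

theorem pos_le_of_lead_le {B B' : BSpline p} {k : Fin 2} {ε : Bool}
    (h : B.lead k ε ≤ B'.lead k ε) : B.pos k ε ≤ B'.pos k ε :=
  Prod.Lex.monotone_fst _ _ h

/-- Links the cover property to the order: `B'` contains the end knot of `B`, so it reaches further
or ends there with no smaller multiplicity. -/
theorem lead_le_of_count_le {B B' : BSpline p} {k : Fin 2} {ε : Bool}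
    (h : (B.mknots k).count (B.endpt k ε) ≤ (B'.mknots k).count (B.endpt k ε)) :
    B.lead k ε ≤ B'.lead k ε := by
  have hm : B.endpt k ε ∈ B'.mknots k :=
    Multiset.count_pos.1 ((Multiset.count_pos.2 (B.endpt_mem k ε)).trans_le h)
  have hp : B.pos k ε ≤ B'.pos k ε := by
    cases ε
    · exact neg_le_neg (B'.lo_le hm)
    · exact B'.le_hi hm
  rw [lead, lead, Prod.Lex.toLex_le_toLex]
  rcases hp.eq_or_lt with h1 | h1
  · exact Or.inr ⟨h1, by rwa [← endpt_eq_of_pos_eq h1]⟩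
  · exact Or.inl h1

theorem HasSupport.carries {M : Mesh} {B : BSpline p} (h : B.HasSupport M) (k : Fin 2) (a : ℝ) :
    M.Carries k a ((B.mknots k).count a) (B.supp.lo (1 - k)) (B.supp.hi (1 - k)) := by
  intro s hs
  by_cases ha : a ∈ B.knots k
  · rw [count_mknots]; exact h.2 k a ha s hs
  · rw [count_mknots, List.count_eq_zero_of_not_mem ha]; exact Nat.zero_le _

/-- The only form in which minimality of the support enters the proof. -/
theorem HasMinimalSupport.le_count {M : Mesh} {B : BSpline p} (h : B.HasMinimalSupport M)
    {k : Fin 2} {a : ℝ} {m : ℕ} (ha : B.Inside k a)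
    (hc : M.Carries k a m (B.supp.lo (1 - k)) (B.supp.hi (1 - k))) :
    m ≤ (B.mknots k).count a := by
  rcases Nat.eq_zero_or_pos m with rfl | hm
  · exact Nat.zero_le _
  · have hmem : B.supp.lo (1 - k) ∈ Set.Ico (B.supp.lo (1 - k)) (B.supp.hi (1 - k)) :=
      ⟨le_rfl, B.lo_lt_hi _⟩
    rw [count_mknots, ← h.2 k a ha.1 ha.2 (fun s hs => hm.trans_le (hc s hs)) _ hmem]
    exact hc _ hmem

theorem inside_of_mem {B B' : BSpline p} {k : Fin 2} {ε : Bool} {a : ℝ} (ha : a ∈ B'.mknots k)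
    (h1 : B'.pos k ε = B.pos k ε) (h2 : B'.pos k (!ε) < B.pos k (!ε)) (hne : a ≠ B.endpt k ε) :
    B.Inside k a := by
  have hl := B'.lo_le ha
  have hh := B'.le_hi ha
  cases ε <;> simp only [pos, endpt, cond, Bool.not_true, Bool.not_false] at h1 h2 hne
  · exact ⟨lt_of_le_of_ne (by linarith) hne.symm, by linarith⟩
  · exact ⟨by linarith, lt_of_le_of_ne (by linarith) hne⟩

theorem pos_eq_of_mknots_eq {B B' : BSpline p} {k : Fin 2} (h : B.mknots k = B'.mknots k)
    (ε : Bool) : B.pos k ε = B'.pos k ε := by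
  have h1 := B.lo_le (h ▸ B'.lo_mem k)
  have h2 := B'.lo_le (h ▸ B.lo_mem k)
  have h3 := B.le_hi (h ▸ B'.hi_mem k)
  have h4 := B'.le_hi (h ▸ B.hi_mem k)
  cases ε
  · exact congrArg Neg.neg (le_antisymm h1 h2)
  · exact le_antisymm h4 h3

/-- A shorter knot vector with the same end has a knot of larger multiplicity inside the longer
one. -/
theorem exists_count_lt {e s : BSpline p} {k : Fin 2} {ε : Bool} (h1 : s.lead k ε = e.lead k ε)
    (h2 : s.pos k (!ε) < e.pos k (!ε)) :
    ∃ u, e.Inside k u ∧ (e.mknots k).count u < (s.mknots k).count u := by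
  by_contra! h
  obtain ⟨h3, h4⟩ := lead_eq_iff.1 h1
  -- Inclusion of multisets of equal cardinality is equality, which contradicts the different far
  -- ends.
  have hle : s.mknots k ≤ e.mknots k := by
    rw [Multiset.le_iff_count]
    intro a
    by_cases ha : a ∈ s.mknots k
    · by_cases hae : a = e.endpt k ε
      · rw [endpt_eq_of_pos_eq h3] at h4
        rw [hae, h4]
      · exact h a (inside_of_mem ha h3 h2 hae)
    · rw [Multiset.count_eq_zero.2 ha]; exact Nat.zero_le _
  have := Multiset.eq_of_le_of_card_le hle (by rw [card_mknots, card_mknots])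
  exact h2.ne (pos_eq_of_mknots_eq this _)

theorem count_le_of_pos_le {M : Mesh} {B B' : BSpline p} (hB : B.HasMinimalSupport M)
    (hB' : B'.HasSupport M) {k : Fin 2} (h : ∀ ε, B.pos (1 - k) ε ≤ B'.pos (1 - k) ε) {a : ℝ}
    (ha : B.Inside k a) : (B'.mknots k).count a ≤ (B.mknots k).count a :=
  hB.le_count ha ((hB'.carries k a).mono le_rfl (neg_le_neg_iff.1 (h false)) (h true))

/-- If `B` reached further, the shorter `B'` would have an excess knot inside `B`. Its line crosses
`B`, because `B'` is at least as wide in the other direction, against minimality of `B`. -/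
theorem pos_le_of_pos_le {M : Mesh} {B B' : BSpline p} (hB : B.HasMinimalSupport M)
    (hB' : B'.HasSupport M) {k : Fin 2} (h : ∀ ε, B.pos (1 - k) ε ≤ B'.pos (1 - k) ε) {ε : Bool}
    (h1 : B.lead k ε = B'.lead k ε) : B.pos k (!ε) ≤ B'.pos k (!ε) := by
  by_contra! h2
  obtain ⟨u, hu, hlt⟩ := exists_count_lt h1.symm h2
  exact hlt.not_ge (count_le_of_pos_le hB hB' h hu)

theorem mknots_eq_of_inside {B B' : BSpline p} {k : Fin 2} {ε : Bool} (h1 : B.lead k ε = B'.lead k ε)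
    (h2 : B.pos k (!ε) = B'.pos k (!ε))
    (h : ∀ a, B.Inside k a → (B.mknots k).count a = (B'.mknots k).count a) :
    B.mknots k = B'.mknots k := by
  obtain ⟨h3, h4⟩ := lead_eq_iff.1 h1
  have e1 := endpt_eq_of_pos_eq h3
  have e2 := endpt_eq_of_pos_eq h2
  have key : ∀ a, a ≠ B.endpt k (!ε) → (B.mknots k).count a = (B'.mknots k).count a := by
    intro a ha
    by_cases ha' : a = B.endpt k ε
    · rw [ha', h4, e1]
    by_cases hin : B.Inside k a
    · exact h a hin
    have aux : ∀ C : BSpline p, C.endpt k ε = B.endpt k ε → C.endpt k (!ε) = B.endpt k (!ε) →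
        a ∉ C.mknots k := by
      intro C h5 h6 hmem
      have hl := C.lo_le hmem
      have hh := C.le_hi hmem
      apply hin
      cases ε <;> simp only [endpt, cond, Bool.not_true, Bool.not_false] at h5 h6 ha ha'
      · rw [h5] at hl; rw [h6] at hh
        exact ⟨lt_of_le_of_ne hl (Ne.symm ha'), lt_of_le_of_ne hh ha⟩
      · rw [h6] at hl; rw [h5] at hh
        exact ⟨lt_of_le_of_ne hl (Ne.symm ha), lt_of_le_of_ne hh ha'⟩
    rw [Multiset.count_eq_zero.2 (aux B rfl rfl), Multiset.count_eq_zero.2 (aux B' e1.symm e2.symm)]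
  -- Multiplicities agree away from the far end, so equal cardinality settles the far end.
  have hcard : (B.mknots k).card = (B'.mknots k).card := by rw [card_mknots, card_mknots]
  rcases le_total ((B.mknots k).count (B.endpt k (!ε))) ((B'.mknots k).count (B.endpt k (!ε)))
    with h5 | h5
  · refine Multiset.eq_of_le_of_card_le (Multiset.le_iff_count.2 fun a => ?_) hcard.ge
    by_cases ha : a = B.endpt k (!ε)
    · rw [ha]; exact h5
    · exact (key a ha).le
  · refine (Multiset.eq_of_le_of_card_le (Multiset.le_iff_count.2 fun a => ?_) hcard.le).symm
    by_cases ha : a = B.endpt k (!ε)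
    · rw [ha]; exact h5
    · exact (key a ha).ge

theorem forall_side {P : Bool → Prop} (ε : Bool) (h1 : P ε) (h2 : P (!ε)) : ∀ ε', P ε' := by
  intro ε'; cases ε <;> cases ε' <;> assumption

theorem forall_dir {P : Fin 2 → Prop} (k : Fin 2) (h1 : P k) (h2 : P (1 - k)) : ∀ j, P j := by
  intro j; fin_cases k <;> fin_cases j <;> assumption

/-- Two distinct minimal support B-splines that share a corner are nested. -/
theorem nested_of_lead_eq {M : Mesh} {B B' : BSpline p} (hB : B.HasMinimalSupport M)
    (hB' : B'.HasMinimalSupport M) (hne : B ≠ B') {c : Fin 2 → Bool}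
    (h : ∀ k, B.lead k (c k) = B'.lead k (c k)) :
    (∀ k, B.pos k (!(c k)) < B'.pos k (!(c k))) ∨ ∀ k, B'.pos k (!(c k)) < B.pos k (!(c k)) := by
  have step : ∀ {B B' : BSpline p}, B.HasMinimalSupport M → B'.HasMinimalSupport M →
      (∀ k, B.lead k (c k) = B'.lead k (c k)) → ∀ k, B.pos (1 - k) (!(c (1 - k))) ≤
        B'.pos (1 - k) (!(c (1 - k))) → B.pos k (!(c k)) ≤ B'.pos k (!(c k)) := by
    intro B B' hB hB' h k hk
    exact pos_le_of_pos_le hB hB'.1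
      (forall_side (c (1 - k)) (lead_eq_iff.1 (h (1 - k))).1.le hk) (h k)
  have all : ∀ {B B' : BSpline p}, B.HasMinimalSupport M → B'.HasMinimalSupport M →
      (∀ k, B.lead k (c k) = B'.lead k (c k)) → ∀ k, B.pos k (!(c k)) ≤ B'.pos k (!(c k)) →
        ∀ j, B.pos j (!(c j)) ≤ B'.pos j (!(c j)) := by
    intro B B' hB hB' h k hk
    exact forall_dir k hk (step hB hB' h (1 - k) (by rwa [sub_sub_cancel]))
  have main : ∀ {B B' : BSpline p}, B.HasMinimalSupport M → B'.HasMinimalSupport M → B ≠ B' →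
      (∀ k, B.lead k (c k) = B'.lead k (c k)) → B.pos 0 (!(c 0)) ≤ B'.pos 0 (!(c 0)) →
        ∀ k, B.pos k (!(c k)) < B'.pos k (!(c k)) := by
    intro B B' hB hB' hne h h0
    -- Without strict inequality in some direction, the comparison holds both ways in all
    -- directions. The supports then coincide, and minimality makes the inner knots agree.
    by_contra! hcon
    obtain ⟨k, hk⟩ := hcon
    have le := all hB hB' h 0 h0
    have ge := all hB' hB (fun k => (h k).symm) k hk
    have eq : ∀ k ε, B.pos k ε = B'.pos k ε := fun k =>
      forall_side (c k) (lead_eq_iff.1 (h k)).1 (le_antisymm (le k) (ge k))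
    refine hne (ext_mknots fun j => mknots_eq_of_inside (h j) (eq j _) fun a ha => ?_)
    have ha' : B'.Inside j a := by
      have e0 := eq j false
      have e1 := eq j true
      simp only [pos, cond, neg_inj] at e0 e1
      rwa [Inside, ← e0, ← e1]
    exact le_antisymm (count_le_of_pos_le hB' hB.1 (fun ε => (eq _ ε).ge) ha')
      (count_le_of_pos_le hB hB'.1 (fun ε => (eq _ ε).le) ha)
  rcases le_total (B.pos 0 (!(c 0))) (B'.pos 0 (!(c 0))) with h0 | h0
  · exact Or.inl (main hB hB' hne h h0)
  · exact Or.inr (main hB' hB hne.symm (fun k => (h k).symm) h0)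

theorem mem_Icc {B : BSpline p} {k : Fin 2} {a : ℝ} (h : a ∈ B.mknots k) :
    a ∈ Set.Icc (B.supp.lo k) (B.supp.hi k) := ⟨B.lo_le h, B.le_hi h⟩

/-- Two overlapping B-splines that both have a knot of larger multiplicity than the minimal support
B-spline `e` do not extend from one side of `e` to the other. -/
theorem pos_lt_of_count_lt {M : Mesh} {e i : BSpline p} (he : e.HasMinimalSupport M) {k : Fin 2}
    {w : ℝ} {m : ℕ} {l h : ℝ} (hs : M.Carries (1 - k) w m l h) (hi : i.HasSupport M)
    {δ : Bool} (hpos : e.pos k δ ≤ cond δ h (-l)) (hw : e.Inside (1 - k) w)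
    (hlt : (e.mknots (1 - k)).count w < m) (hle : m ≤ (i.mknots (1 - k)).count w) {u : ℝ}
    (hu : u ∈ Set.Icc l h) (hu' : u ∈ Set.Icc (i.supp.lo k) (i.supp.hi k)) :
    i.pos k (!δ) < e.pos k (!δ) := by
  by_contra! hcon
  have hic := (hi.carries (1 - k) w).mono hle le_rfl le_rfl
  rw [sub_sub_cancel] at hic
  -- If `i` reached the opposite side, the two segments, which share the point `u`, would together
  -- cross `e` with multiplicity `m`.
  refine hlt.not_ge (he.le_count hw ?_)
  rw [sub_sub_cancel]
  refine (hs.union hic hu hu').mono le_rfl ?_ ?_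
  · cases δ <;> simp only [pos, cond, Bool.not_true, Bool.not_false] at hpos hcon
    · exact min_le_of_left_le (by linarith)
    · exact min_le_of_right_le (by linarith)
  · cases δ <;> simp only [pos, cond, Bool.not_true, Bool.not_false] at hpos hcon
    · exact le_max_of_le_right (by linarith)
    · exact le_max_of_le_left (by linarith)

end BSpline

end LRSpline

/-! ### Six dependent B-splines form a pinwheel -/

namespace LRSpline
open BSpline
variable {p : Fin 2 → ℕ} {M : Mesh} {B : Fin 6 → BSpline p}

/-- Six distinct minimal support B-splines with a linear relation in which no coefficient vanishes,
written in terms of divided differences. -/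
structure Dependent (M : Mesh) (B : Fin 6 → BSpline p) : Prop where
  inj : Function.Injective B
  ms : ∀ j, (B j).HasMinimalSupport M
  rel : ∀ k, ∃ β : Fin 6 → ℝ, (∀ j, β j ≠ 0) ∧ ∀ f g : ℝ[X],
    ∑ j, β j * dd ((B j).mknots k) f * dd ((B j).mknots (1 - k)) g = 0

theorem Dependent.cov (D : Dependent M B) (i : Fin 6) {z : Fin 2 → ℝ}
    (hz : ∀ k, z k ∈ (B i).mknots k) :
    ∃ j, j ≠ i ∧ ∀ k, ((B i).mknots k).count (z k) ≤ ((B j).mknots k).count (z k) := by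
  obtain ⟨β, hβ, hrel⟩ := D.rel 0
  obtain ⟨j, hj, h0, h1⟩ := exists_ne_count_le hβ hrel i (hz 0) (hz 1)
  exact ⟨j, hj, forall_dir 0 h0 h1⟩

/-- The cover property with the two directions in the order `k`, `1 - k`. -/
theorem Dependent.cov' (D : Dependent M B) (i : Fin 6) (k : Fin 2) {u v : ℝ}
    (hu : u ∈ (B i).mknots k) (hv : v ∈ (B i).mknots (1 - k)) :
    ∃ j, j ≠ i ∧ ((B i).mknots k).count u ≤ ((B j).mknots k).count u ∧
      ((B i).mknots (1 - k)).count v ≤ ((B j).mknots (1 - k)).count v := by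
  obtain ⟨β, hβ, hrel⟩ := D.rel k
  exact exists_ne_count_le hβ hrel i hu hv

/-- The corner on the side `δ` in direction `1` and `ε` in direction `0`. -/
def sides (δ ε : Bool) : Fin 2 → Bool := ![ε, δ]

/-- Maximise `lead 1 δ` first and `lead 0 ε` among the ties. The cover property at the extremal
corner gives a second B-spline with the same leads, and `nested_of_lead_eq` orders the two. Note
that the extent in direction `0` is maximal among the ties only. -/
theorem Dependent.exists_corner (D : Dependent M B) (δ ε : Bool) : ∃ s e : Fin 6,
    (∀ j, (B j).lead 1 δ ≤ (B s).lead 1 δ) ∧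
    (∀ j, (B j).lead 1 δ = (B s).lead 1 δ → (B j).lead 0 ε ≤ (B s).lead 0 ε) ∧
    (∀ k, (B s).lead k (sides δ ε k) = (B e).lead k (sides δ ε k)) ∧
    ∀ k, (B s).pos k (!(sides δ ε k)) < (B e).pos k (!(sides δ ε k)) := by
  classical
  obtain ⟨i0, -, hi0⟩ := Finset.exists_max_image Finset.univ (fun j => (B j).lead 1 δ)
    ⟨0, Finset.mem_univ _⟩
  obtain ⟨i, hi, hmax⟩ := Finset.exists_max_image
    (Finset.univ.filter fun j => (B j).lead 1 δ = (B i0).lead 1 δ) (fun j => (B j).lead 0 ε)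
    ⟨i0, by simp⟩
  replace hi := (Finset.mem_filter.1 hi).2
  replace hi0 : ∀ j, (B j).lead 1 δ ≤ (B i).lead 1 δ := fun j => hi ▸ hi0 j (Finset.mem_univ j)
  replace hmax : ∀ j, (B j).lead 1 δ = (B i).lead 1 δ → (B j).lead 0 ε ≤ (B i).lead 0 ε :=
    fun j hj => hmax j (by simp [hj, hi])
  obtain ⟨j, hji, hj⟩ := D.cov i (z := fun k => (B i).endpt k (sides δ ε k))
    fun k => (B i).endpt_mem k _
  have h1 : (B j).lead 1 δ = (B i).lead 1 δ := le_antisymm (hi0 j) (lead_le_of_count_le (hj 1))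
  have h0 : (B j).lead 0 ε = (B i).lead 0 ε :=
    le_antisymm (hmax j h1) (lead_le_of_count_le (hj 0))
  have hc : ∀ k, (B i).lead k (sides δ ε k) = (B j).lead k (sides δ ε k) :=
    forall_dir 0 h0.symm h1.symm
  rcases nested_of_lead_eq (D.ms i) (D.ms j) (D.inj.ne hji.symm) hc with h | h
  · exact ⟨i, j, hi0, hmax, hc, h⟩
  · exact ⟨j, i, fun k => h1 ▸ hi0 k, fun k hk => h0 ▸ hmax k (hk.trans h1),
      fun k => (hc k).symm, h⟩

/-- For a B-spline `s` nested into `e` at a corner, a third B-spline contains the knots that `s` has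
in excess of `e`, and it does not reach the two other sides of `e`. -/
theorem Dependent.exists_third (D : Dependent M B) {s e : Fin 6} {c : Fin 2 → Bool}
    (h1 : ∀ k, (B s).lead k (c k) = (B e).lead k (c k))
    (h2 : ∀ k, (B s).pos k (!(c k)) < (B e).pos k (!(c k))) {z : Fin 2 → ℝ}
    (hin : ∀ k, (B e).Inside k (z k))
    (hlt : ∀ k, ((B e).mknots k).count (z k) < ((B s).mknots k).count (z k)) :
    ∃ i, i ≠ s ∧ i ≠ e ∧ (∀ k, (B i).pos k (!(c k)) < (B e).pos k (!(c k))) ∧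
      ∀ k, ((B s).mknots k).count (z k) ≤ ((B i).mknots k).count (z k) := by
  have hz : ∀ k, z k ∈ (B s).mknots k := fun k =>
    Multiset.count_pos.1 ((Nat.zero_le _).trans_lt (hlt k))
  obtain ⟨i, his, hi⟩ := D.cov s hz
  have hz' : ∀ k, z k ∈ (B i).mknots k := fun k =>
    Multiset.count_pos.1 ((Multiset.count_pos.2 (hz k)).trans_le (hi k))
  refine ⟨i, his, ?_, fun k => ?_, hi⟩
  · rintro rfl; exact (hlt 0).not_ge (hi 0)
  · have hc := (D.ms s).1.carries (1 - k) (z (1 - k))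
    rw [sub_sub_cancel] at hc
    refine pos_lt_of_count_lt (D.ms e) hc (D.ms i).1 ?_ (hin (1 - k)) (hlt (1 - k)) (hi (1 - k))
      (mem_Icc (hz k)) (mem_Icc (hz' k))
    exact (lead_eq_iff.1 (h1 k)).1.ge

/-- The configuration of six linearly dependent B-splines: `s c` is nested into `e` at the corner `c`,
and `f` lies in the interior of the support of `e`. -/
structure Pinwheel (B : Fin 6 → BSpline p) (e f : Fin 6) (s : (Fin 2 → Bool) → Fin 6) : Prop where
  lead_eq : ∀ c k, (B (s c)).lead k (c k) = (B e).lead k (c k)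
  pos_lt : ∀ c k, (B (s c)).pos k (!(c k)) < (B e).pos k (!(c k))
  inner : ∀ k ε, (B f).pos k ε < (B e).pos k ε
  exhaust : ∀ i, i = e ∨ i = f ∨ ∃ c, i = s c

theorem Dependent.exists_pinwheel (D : Dependent M B) : ∃ e f s, Pinwheel B e f s := by
  classical
  choose s E hm hm' hl hp using D.exists_corner
  have hl1 : ∀ δ ε, (B (s δ ε)).lead 1 δ = (B (E δ ε)).lead 1 δ := fun δ ε => hl δ ε 1
  have hl0 : ∀ δ ε, (B (s δ ε)).lead 0 ε = (B (E δ ε)).lead 0 ε := fun δ ε => hl δ ε 0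
  have hp1 : ∀ δ ε, (B (s δ ε)).pos 1 (!δ) < (B (E δ ε)).pos 1 (!δ) := fun δ ε => hp δ ε 1
  have hp0 : ∀ δ ε, (B (s δ ε)).pos 0 (!ε) < (B (E δ ε)).pos 0 (!ε) := fun δ ε => hp δ ε 0
  have hs1 : ∀ δ ε ε', (B (s δ ε)).lead 1 δ = (B (s δ ε')).lead 1 δ := fun δ ε ε' =>
    le_antisymm (hm _ _ _) (hm _ _ _)
  have hE1 : ∀ δ ε ε', (B (E δ ε')).lead 1 δ = (B (s δ ε)).lead 1 δ := fun δ ε ε' =>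
    (hl1 δ ε').symm.trans (hs1 δ _ _)
  -- the B-splines at the corner `(δ, ε)` reach the sides `δ` and `ε`
  have r1 : ∀ δ ε j, (B j).pos 1 δ ≤ (B (s δ ε)).pos 1 δ := fun δ ε j =>
    pos_le_of_lead_le (hm δ ε j)
  have r1' : ∀ δ ε j, (B j).pos 1 δ ≤ (B (E δ ε)).pos 1 δ := fun δ ε j =>
    pos_le_of_lead_le (hl1 δ ε ▸ hm δ ε j)
  have r0 : ∀ δ ε ε', (B (E δ ε')).pos 0 ε ≤ (B (s δ ε)).pos 0 ε := fun δ ε ε' =>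
    pos_le_of_lead_le (hm' δ ε _ (hE1 δ ε ε'))
  have r0' : ∀ δ ε ε', (B (E δ ε')).pos 0 ε ≤ (B (E δ ε)).pos 0 ε := fun δ ε ε' =>
    pos_le_of_lead_le (hl0 δ ε ▸ hm' δ ε _ (hE1 δ ε ε'))
  -- A small B-spline `s δ ε` stays short of the far sides of `E δ ε`, while the B-splines at
  -- another corner reach at least one of them.
  have hsE : ∀ δ ε δ' ε', s δ ε ≠ E δ' ε' := by
    intro δ ε δ' ε' h
    by_cases hδ : δ' = δ
    · subst hδ
      by_cases hε : ε' = ε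
      · subst hε; exact (hp1 δ' ε').ne (by rw [h])
      · obtain rfl : ε' = !ε := by revert hε; cases ε <;> cases ε' <;> simp
        exact (hp0 δ' ε).not_ge (h ▸ r0' δ' (!ε) ε)
    · obtain rfl : δ' = !δ := by revert hδ; cases δ <;> cases δ' <;> simp
      exact (hp1 δ ε).not_ge (h ▸ r1' (!δ) ε' _)
  have hss : Function.Injective fun x : Bool × Bool => s x.1 x.2 := by
    rintro ⟨δ, ε⟩ ⟨δ', ε'⟩ h
    simp only at h
    by_cases hδ : δ' = δ
    · subst hδ
      by_cases hε : ε' = ε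
      · rw [hε]
      · obtain rfl : ε' = !ε := by revert hε; cases ε <;> cases ε' <;> simp
        exact absurd (h ▸ r0 δ' (!ε) ε) (hp0 δ' ε).not_ge
    · obtain rfl : δ' = !δ := by revert hδ; cases δ <;> cases δ' <;> simp
      exact absurd (h ▸ r1 (!δ) ε' _) (hp1 δ ε).not_ge
  -- the third B-spline at a corner is none of the B-splines at the corners
  have hthird : ∀ δ ε, ∃ i, (∀ δ' ε', i ≠ s δ' ε') ∧ (∀ δ' ε', i ≠ E δ' ε') ∧
      (B i).pos 0 (!ε) < (B (E δ ε)).pos 0 (!ε) ∧ (B i).pos 1 (!δ) < (B (E δ ε)).pos 1 (!δ) := by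
    intro δ ε
    choose z hin hlt using fun k => exists_count_lt (hl δ ε k) (hp δ ε k)
    obtain ⟨i, his, hiE, hi, -⟩ := D.exists_third (hl δ ε) (hp δ ε) hin hlt
    have hi0 : (B i).pos 0 (!ε) < (B (E δ ε)).pos 0 (!ε) := hi 0
    have hi1 : (B i).pos 1 (!δ) < (B (E δ ε)).pos 1 (!δ) := hi 1
    refine ⟨i, fun δ' ε' => ?_, fun δ' ε' => ?_, hi0, hi1⟩
    · rintro rfl
      by_cases hδ : δ' = δ
      · subst hδ
        by_cases hε : ε' = ε
        · subst hε; exact his rfl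
        · obtain rfl : ε' = !ε := by revert hε; cases ε <;> cases ε' <;> simp
          exact hi0.not_ge (r0 _ _ _)
      · obtain rfl : δ' = !δ := by revert hδ; cases δ <;> cases δ' <;> simp
        exact hi1.not_ge (r1 _ _ _)
    · rintro rfl
      by_cases hδ : δ' = δ
      · subst hδ
        by_cases hε : ε' = ε
        · subst hε; exact hiE rfl
        · obtain rfl : ε' = !ε := by revert hε; cases ε <;> cases ε' <;> simp
          exact hi0.not_ge (r0' _ _ _)
      · obtain rfl : δ' = !δ := by revert hδ; cases δ <;> cases δ' <;> simp
        exact hi1.not_ge (r1' _ _ _)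
  -- The four distinct small B-splines leave two indices for all `E δ ε` and all third B-splines. No
  -- third one is an `E`, so each kind is a single index.
  set S : Finset (Fin 6) := Finset.univ.image fun x : Bool × Bool => s x.1 x.2 with hS
  have hSc : Sᶜ.card = 2 := by
    rw [Finset.card_compl, hS, Finset.card_image_of_injective _ hss]; rfl
  have hmS : ∀ i, (∀ δ ε, i ≠ s δ ε) → i ∈ Sᶜ := by
    intro i hi
    simp only [hS, Finset.mem_compl, Finset.mem_image, not_exists, not_and]
    exact fun x _ h => hi x.1 x.2 h.symm
  obtain ⟨f, hfs, hfE, -, -⟩ := hthird true true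
  set e := E true true
  have hpair : ({e, f} : Finset (Fin 6)) = Sᶜ := by
    apply Finset.eq_of_subset_of_card_le
    · intro i hi
      rcases Finset.mem_insert.1 hi with rfl | hi
      · exact hmS _ fun δ ε => (hsE δ ε true true).symm
      · rw [Finset.mem_singleton.1 hi]; exact hmS _ hfs
    · rw [hSc, Finset.card_pair (hfE true true).symm]
  have hcases : ∀ i, (∀ δ ε, i ≠ s δ ε) → i = e ∨ i = f := by
    intro i hi
    have := hmS i hi
    rw [← hpair] at this
    simpa using this
  have hEe : ∀ δ ε, E δ ε = e := fun δ ε =>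
    (hcases _ fun δ' ε' => (hsE δ' ε' δ ε).symm).resolve_right (hfE δ ε).symm
  have hf : ∀ δ ε, (B f).pos 0 (!ε) < (B e).pos 0 (!ε) ∧ (B f).pos 1 (!δ) < (B e).pos 1 (!δ) := by
    intro δ ε
    obtain ⟨i, h1, h2, h3, h4⟩ := hthird δ ε
    obtain rfl := (hcases i h1).resolve_left (h2 true true)
    rw [hEe] at h3 h4
    exact ⟨h3, h4⟩
  have hsides : ∀ c : Fin 2 → Bool, sides (c 1) (c 0) = c := fun c => by
    ext k; fin_cases k <;> rfl
  refine ⟨e, f, fun c => s (c 1) (c 0), fun c k => ?_, fun c k => ?_, ?_, fun i => ?_⟩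
  · have := hl (c 1) (c 0) k
    rwa [hEe, hsides] at this
  · have := hp (c 1) (c 0) k
    rwa [hEe, hsides] at this
  · refine forall_dir 0 (fun ε => ?_) fun ε => ?_
    · have := (hf true (!ε)).1; rwa [Bool.not_not] at this
    · have := (hf (!ε) true).2; rwa [Bool.not_not] at this
  · by_cases h : ∃ δ ε, i = s δ ε
    · obtain ⟨δ, ε, h⟩ := h
      exact Or.inr (Or.inr ⟨sides δ ε, h⟩)
    · push Not at h
      rcases hcases i h with h | h
      · exact Or.inl h
      · exact Or.inr (Or.inl h)
end LRSpline

/-! ### The knots of a pinwheel -/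

namespace LRSpline
open BSpline
variable {p : Fin 2 → ℕ} {M : Mesh} {B : Fin 6 → BSpline p}

/-- The corner on the side `ε` in direction `k` and on the side `δ` in the other direction. -/
def corner (k : Fin 2) (δ ε : Bool) : Fin 2 → Bool := fun j => if j = k then ε else δ

theorem one_sub_ne (k : Fin 2) : 1 - k ≠ k := by fin_cases k <;> decide

theorem corner_same (k : Fin 2) (δ ε : Bool) : corner k δ ε k = ε := by simp [corner]

theorem corner_other (k : Fin 2) (δ ε : Bool) : corner k δ ε (1 - k) = δ := by
  simp [corner, one_sub_ne]

theorem eq_corner (c : Fin 2 → Bool) (k : Fin 2) : c = corner k (c (1 - k)) (c k) :=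
  funext (forall_dir k (corner_same _ _ _).symm (corner_other _ _ _).symm)

/-- `s` misses two elements of `E` and may gain only `v`, so it is too small. -/
theorem card_contradiction {n : ℕ} {s E : Multiset ℝ} (hs : s.card = n) (hE : E.card = n) {x y v : ℝ}
    (hxy : x ≠ y) (hx : x ∉ s) (hy : y ∉ s) (hxE : x ∈ E) (hyE : y ∈ E) (hle : s ≤ v ::ₘ E) :
    False := by
  have h : s + {x, y} ≤ v ::ₘ E := by
    rw [Multiset.le_iff_count]
    intro a
    have h1 := Multiset.le_iff_count.1 hle a
    have h2 := Multiset.count_pos.2 hxE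
    have h3 := Multiset.count_pos.2 hyE
    rw [Multiset.count_cons] at h1 ⊢
    rw [Multiset.count_add, Multiset.insert_eq_cons, Multiset.count_cons, Multiset.count_singleton]
    by_cases hax : a = x
    · subst hax
      simp only [Multiset.count_eq_zero.2 hx, hxy, if_true, if_false]
      omega
    · by_cases hay : a = y
      · subst hay
        simp only [Multiset.count_eq_zero.2 hy, hax, if_true, if_false]
        omega
      · simp only [hax, hay, if_false]
        omega
  have := Multiset.card_le_card h
  simp [hs, hE] at this

namespace Pinwheel

variable {e f : Fin 6} {s : (Fin 2 → Bool) → Fin 6}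

theorem pos_eq (W : Pinwheel B e f s) (c : Fin 2 → Bool) (k : Fin 2) :
    (B (s c)).pos k (c k) = (B e).pos k (c k) := (lead_eq_iff.1 (W.lead_eq c k)).1

theorem pos_le (W : Pinwheel B e f s) (i : Fin 6) (k : Fin 2) (ε : Bool) :
    (B i).pos k ε ≤ (B e).pos k ε := by
  rcases W.exhaust i with rfl | rfl | ⟨c, rfl⟩
  · exact le_rfl
  · exact (W.inner k ε).le
  · exact forall_side (P := fun ε => (B (s c)).pos k ε ≤ (B e).pos k ε) (c k) (W.pos_eq c k).le
      (W.pos_lt c k).le ε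

theorem exists_excess (W : Pinwheel B e f s) (c : Fin 2 → Bool) : ∃ z : Fin 2 → ℝ,
    ∀ k, (B e).Inside k (z k) ∧ ((B e).mknots k).count (z k) < ((B (s c)).mknots k).count (z k) := by
  choose z hz using fun k => exists_count_lt (W.lead_eq c k) (W.pos_lt c k)
  exact ⟨z, hz⟩

/-- The third B-spline that covers the excess knots must be `f`, since the small one at any other
corner reaches a far side of `e`. -/
theorem excess_le (D : Dependent M B) (W : Pinwheel B e f s) {c : Fin 2 → Bool} {z : Fin 2 → ℝ}
    (hz : ∀ k, (B e).Inside k (z k) ∧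
      ((B e).mknots k).count (z k) < ((B (s c)).mknots k).count (z k)) (k : Fin 2) :
    ((B (s c)).mknots k).count (z k) ≤ ((B f).mknots k).count (z k) := by
  obtain ⟨i, his, hie, hlt, hi⟩ := D.exists_third (W.lead_eq c) (W.pos_lt c) (fun k => (hz k).1)
    fun k => (hz k).2
  rcases W.exhaust i with rfl | rfl | ⟨c', rfl⟩
  · exact absurd rfl hie
  · exact hi k
  · exfalso
    have hne : c' ≠ c := fun h => his (h ▸ rfl)
    obtain ⟨j, hj⟩ := Function.ne_iff.1 hne
    have hj' : c' j = !(c j) := by revert hj; cases c' j <;> cases c j <;> simp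
    have := hlt j
    rw [← hj', W.pos_eq c' j] at this
    exact this.ne rfl

/-- Cover the knot `a` of `f` together with an excess knot of `s c` in the other direction. The
excess rules out `e`. -/
theorem exists_count_inner_le (D : Dependent M B) (W : Pinwheel B e f s) (c : Fin 2 → Bool)
    (k : Fin 2) {a : ℝ} (ha : a ∈ (B f).mknots k) :
    ∃ c', c' k = c k ∧ ((B f).mknots k).count a ≤ ((B (s c')).mknots k).count a := by
  obtain ⟨z, hz⟩ := W.exists_excess c
  have hzs : ∀ k, z k ∈ (B (s c)).mknots k := fun k =>
    Multiset.count_pos.1 ((Nat.zero_le _).trans_lt (hz k).2)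
  have hzf : ∀ k, z k ∈ (B f).mknots k := fun k =>
    Multiset.count_pos.1 ((Multiset.count_pos.2 (hzs k)).trans_le (excess_le D W hz k))
  obtain ⟨i, hif, hia, hiz⟩ := D.cov' f k ha (hzf (1 - k))
  have hle := (excess_le D W hz (1 - k)).trans hiz
  rcases W.exhaust i with rfl | rfl | ⟨c', rfl⟩
  · exact absurd hle (hz (1 - k)).2.not_ge
  · exact absurd rfl hif
  · refine ⟨c', ?_, hia⟩
    by_contra hne
    have hne' : c' k = !(c k) := by revert hne; cases c' k <;> cases c k <;> simp
    have h1 := (D.ms (s c)).1.carries (1 - k) (z (1 - k))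
    have h2 := ((D.ms f).1.carries (1 - k) (z (1 - k))).mono (excess_le D W hz (1 - k)) le_rfl le_rfl
    rw [sub_sub_cancel] at h1 h2
    -- A cover on the opposite side would complete the lines of `s c` and `f` to a line across `e`,
    -- of larger multiplicity than `e` has there.
    have h3 := h1.union h2 (mem_Icc (hzs k)) (mem_Icc (hzf k))
    have hpos := (W.pos_eq c k).ge
    have hai : a ∈ (B (s c')).mknots k :=
      Multiset.count_pos.1 ((Multiset.count_pos.2 ha).trans_le hia)
    have haf := mem_Icc ha
    have h4 := pos_lt_of_count_lt (D.ms e) (k := k) (δ := c k) h3 (D.ms (s c')).1 (by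
        revert hpos
        cases c k <;> simp only [pos, cond]
        · intro h
          exact h.trans (neg_le_neg (min_le_left _ _))
        · intro h
          exact h.trans (le_max_left _ _))
      (hz (1 - k)).1 (hz (1 - k)).2 hle
      ⟨(min_le_right _ _).trans haf.1, haf.2.trans (le_max_right _ _)⟩ (mem_Icc hai)
    have h5 := W.pos_eq c' k
    rw [hne'] at h5
    exact h4.ne h5

/-- The B-splines with at least the same multiplicity on a side of the support of `e`. -/
theorem eq_of_count_le (W : Pinwheel B e f s) {k : Fin 2} {δ : Bool} {i : Fin 6}
    (hi : ((B e).mknots (1 - k)).count ((B e).endpt (1 - k) δ)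
      ≤ ((B i).mknots (1 - k)).count ((B e).endpt (1 - k) δ)) :
    i = e ∨ ∃ ε, i = s (corner k δ ε) := by
  have h := pos_le_of_lead_le (lead_le_of_count_le hi)
  rcases W.exhaust i with rfl | rfl | ⟨c, rfl⟩
  · exact Or.inl rfl
  · exact absurd h (W.inner _ _).not_ge
  · refine Or.inr ⟨c k, ?_⟩
    rw [eq_corner c k]
    congr 2
    · by_contra hne
      have hne' : δ = !(c (1 - k)) := by revert hne; cases δ <;> cases c (1 - k) <;> simp
      rw [hne'] at h
      exact (W.pos_lt c (1 - k)).not_ge h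
    · rw [corner_same]

theorem count_le_of_inside (D : Dependent M B) (W : Pinwheel B e f s) (c : Fin 2 → Bool) (k : Fin 2)
    {a : ℝ} (ha : (B (s c)).Inside k a) :
    ((B e).mknots k).count a ≤ ((B (s c)).mknots k).count a :=
  count_le_of_pos_le (D.ms _) (D.ms _).1 (fun ε => W.pos_le _ _ ε) ha

theorem count_endpt (W : Pinwheel B e f s) (c : Fin 2 → Bool) (k : Fin 2) :
    ((B (s c)).mknots k).count ((B e).endpt k (c k)) = ((B e).mknots k).count ((B e).endpt k (c k)) := by
  have h := (lead_eq_iff.1 (W.lead_eq c k)).2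
  rwa [endpt_eq_of_pos_eq (W.pos_eq c k)] at h

theorem lo_eq (W : Pinwheel B e f s) {c : Fin 2 → Bool} {k : Fin 2} (h : c k = false) :
    (B (s c)).supp.lo k = (B e).supp.lo k := by
  have := W.pos_eq c k
  rw [h] at this
  exact neg_injective this

theorem hi_eq (W : Pinwheel B e f s) {c : Fin 2 → Bool} {k : Fin 2} (h : c k = true) :
    (B (s c)).supp.hi k = (B e).supp.hi k := by
  have := W.pos_eq c k
  rwa [h] at this

/-- Only `e` and the small B-splines at the two ends of the side `δ` have its full multiplicity.
Testing against this side leaves a three-term univariate relation, to which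
`exists_le_cons_of_three_term` applies. -/
theorem exists_le_cons (D : Dependent M B) (W : Pinwheel B e f s) (k : Fin 2) (δ : Bool) :
    ∃ u, ∀ ε, (B (s (corner k δ ε))).mknots k ≤ u ::ₘ (B e).mknots k := by
  classical
  set L := s (corner k δ false) with hL
  set R := s (corner k δ true) with hR
  have hLlo : (B L).supp.lo k = (B e).supp.lo k := W.lo_eq (corner_same _ _ _)
  have hRhi : (B R).supp.hi k = (B e).supp.hi k := W.hi_eq (corner_same _ _ _)
  have hLlt : (B L).supp.hi k < (B e).supp.hi k := by
    have := W.pos_lt (corner k δ false) k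
    rwa [corner_same] at this
  have hRlt : (B e).supp.lo k < (B R).supp.lo k := by
    have := W.pos_lt (corner k δ true) k
    rw [corner_same] at this
    exact neg_lt_neg_iff.1 this
  have heL : e ≠ L := by intro h; rw [← h] at hLlt; exact hLlt.false
  have heR : e ≠ R := by intro h; rw [← h] at hRlt; exact hRlt.false
  have hLR : L ≠ R := by intro h; rw [h] at hLlt; exact hLlt.ne hRhi
  have hthree : ∀ i, ((B e).mknots (1 - k)).count ((B e).endpt (1 - k) δ)
      ≤ ((B i).mknots (1 - k)).count ((B e).endpt (1 - k) δ) → i = e ∨ i = L ∨ i = R := by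
    intro i hi
    rcases W.eq_of_count_le hi with h | ⟨ε, h⟩
    · exact Or.inl h
    · cases ε
      exacts [Or.inr (Or.inl h), Or.inr (Or.inr h)]
  have hcL : ∀ ε, ((B (s (corner k δ ε))).mknots (1 - k)).count ((B e).endpt (1 - k) δ)
      = ((B e).mknots (1 - k)).count ((B e).endpt (1 - k) δ) := by
    intro ε
    have := W.count_endpt (corner k δ ε) (1 - k)
    rwa [corner_other] at this
  obtain ⟨β, hβ, hrel⟩ := D.rel k
  obtain ⟨g, hg⟩ := exists_dd_lead (fun i => (B i).mknots (1 - k)) ((B e).endpt (1 - k) δ)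
    (Multiset.count_pos.2 ((B e).endpt_mem (1 - k) δ))
  set w : Fin 6 → ℝ := fun i => β i * dd ((B i).mknots (1 - k)) g
  have hw : ∀ ε, w (s (corner k δ ε)) ≠ 0 := fun ε => mul_ne_zero (hβ _) ((hg _).2 (hcL ε))
  have hrel' : ∀ h, w e * dd ((B e).mknots k) h + w L * dd ((B L).mknots k) h
      + w R * dd ((B R).mknots k) h = 0 := by
    intro h
    rw [← hrel h g, ← Finset.sum_subset (Finset.subset_univ {e, L, R}),
      Finset.sum_insert (by simp [heL, heR]), Finset.sum_insert (by simp [hLR]), Finset.sum_singleton]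
    · simp only [w]; ring
    · intro i _ hi
      rw [(hg i).1, mul_zero]
      by_contra hcon
      apply hi
      simpa using hthree i (not_lt.1 hcon)
  -- Pairing `x` with the end knot on the side `δ` keeps the covering B-spline among the three.
  have cov : ∀ i, i = e ∨ i = L ∨ i = R → ∀ x ∈ (B i).mknots k, ∃ j, j ≠ i ∧
      (j = e ∨ j = L ∨ j = R) ∧ ((B i).mknots k).count x ≤ ((B j).mknots k).count x := by
    intro i hi x hx
    have hci : ((B i).mknots (1 - k)).count ((B e).endpt (1 - k) δ)
        = ((B e).mknots (1 - k)).count ((B e).endpt (1 - k) δ) := by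
      rcases hi with rfl | rfl | rfl
      exacts [rfl, hcL _, hcL _]
    obtain ⟨j, hji, hj, hj'⟩ := D.cov' i k hx (v := (B e).endpt (1 - k) δ)
      (Multiset.count_pos.1 (hci ▸ Multiset.count_pos.2 ((B e).endpt_mem _ _)))
    exact ⟨j, hji, hthree j (hci ▸ hj'), hj⟩
  have hkey : ∃ u, (B L).mknots k ≤ u ::ₘ (B e).mknots k ∧ (B R).mknots k ≤ u ::ₘ (B e).mknots k := by
    refine exists_le_cons_of_three_term ((B e).card_mknots k) ((B L).card_mknots k)
      ((B R).card_mknots k) (hw false) (hw true) hrel' (fun x hx => (B L).le_hi hx)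
      (fun x hx => (B R).lo_le hx) ?_ ?_ ?_ ?_ ?_
    · intro x hx
      by_cases hxe : x ∈ (B e).mknots k
      · rcases ((B e).lo_le hxe).eq_or_lt with h | h
        · have h1 := W.count_endpt (corner k δ false) k
          rw [corner_same] at h1
          rw [← h]; exact h1.ge
        · exact count_le_of_inside D W _ k ⟨hLlo.trans_lt h, hx⟩
      · rw [Multiset.count_eq_zero.2 hxe]; exact Nat.zero_le _
    · intro x hx
      by_cases hxe : x ∈ (B e).mknots k
      · rcases ((B e).le_hi hxe).eq_or_lt with h | h
        · have h1 := W.count_endpt (corner k δ true) k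
          rw [corner_same] at h1
          rw [h]; exact h1.ge
        · exact count_le_of_inside D W _ k ⟨hx, h.trans_eq hRhi.symm⟩
      · rw [Multiset.count_eq_zero.2 hxe]; exact Nat.zero_le _
    · intro x hx
      obtain ⟨j, hj, rfl | rfl | rfl, h⟩ := cov e (Or.inl rfl) x hx
      exacts [absurd rfl hj, Or.inl h, Or.inr h]
    · intro x hx
      obtain ⟨j, hj, h1 | h1 | h1, h⟩ := cov L (Or.inr (Or.inl rfl)) x hx
      · exact Or.inl (h1 ▸ h)
      · exact absurd h1 hj
      · exact Or.inr (h1 ▸ h)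
    · intro x hx
      obtain ⟨j, hj, h1 | h1 | h1, h⟩ := cov R (Or.inr (Or.inr rfl)) x hx
      · exact Or.inl (h1 ▸ h)
      · exact Or.inr (h1 ▸ h)
      · exact absurd h1 hj
  obtain ⟨u, h1, h2⟩ := hkey
  refine ⟨u, fun ε => ?_⟩
  cases ε
  exacts [h1, h2]

theorem lo_lt_inner (W : Pinwheel B e f s) (k : Fin 2) : (B e).supp.lo k < (B f).supp.lo k :=
  neg_lt_neg_iff.1 (W.inner k false)

theorem inner_lt_hi (W : Pinwheel B e f s) (k : Fin 2) : (B f).supp.hi k < (B e).supp.hi k :=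
  W.inner k true

theorem lo_not_mem (W : Pinwheel B e f s) (k : Fin 2) : (B e).supp.lo k ∉ (B f).mknots k :=
  fun h => (W.lo_lt_inner k).not_ge ((B f).lo_le h)

theorem hi_not_mem (W : Pinwheel B e f s) (k : Fin 2) : (B e).supp.hi k ∉ (B f).mknots k :=
  fun h => (W.inner_lt_hi k).not_ge ((B f).le_hi h)

/-- The inner B-spline has the knots of the outer one without the end knots, and two more knots. -/
theorem mknots_inner (D : Dependent M B) (W : Pinwheel B e f s) {k : Fin 2} {u : Bool → ℝ}
    (hu : ∀ δ ε, (B (s (corner k δ ε))).mknots k ≤ u δ ::ₘ (B e).mknots k) :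
    (B f).mknots k + {(B e).supp.lo k, (B e).supp.hi k}
      = (B e).mknots k + {u false, u true} := by
  apply Multiset.eq_of_le_of_card_le
  · rw [Multiset.le_iff_count]
    intro a
    simp only [Multiset.count_add, Multiset.insert_eq_cons, Multiset.count_cons,
      Multiset.count_singleton]
    have hlt := (B e).lo_lt_hi k
    by_cases h1 : a = (B e).supp.lo k
    · rw [h1, Multiset.count_eq_zero.2 (W.lo_not_mem k), if_neg hlt.ne, if_pos rfl]
      have := Multiset.count_pos.2 ((B e).lo_mem k)
      omega
    by_cases h2 : a = (B e).supp.hi k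
    · rw [h2, Multiset.count_eq_zero.2 (W.hi_not_mem k), if_neg hlt.ne', if_pos rfl]
      have := Multiset.count_pos.2 ((B e).hi_mem k)
      omega
    rw [if_neg h1, if_neg h2]
    by_cases ha : a ∈ (B f).mknots k
    · obtain ⟨c, -, hc⟩ := exists_count_inner_le D W (fun _ => true) k ha
      have h3 := Multiset.le_iff_count.1 (hu (c (1 - k)) (c k)) a
      rw [← eq_corner, Multiset.count_cons] at h3
      revert h3
      cases c (1 - k) <;> intro h3 <;> omega
    · rw [Multiset.count_eq_zero.2 ha]; exact Nat.zero_le _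
  · simp [card_mknots]

/-- By `mknots_inner` the inner end of `s c` is a knot of `f` or an end of `e`, and the latter is
impossible. -/
theorem pos_le_inner (D : Dependent M B) (W : Pinwheel B e f s) (c : Fin 2 → Bool) (k : Fin 2) :
    (B (s c)).pos k (!(c k)) ≤ (B f).pos k (!(c k)) := by
  choose u hu using exists_le_cons D W k
  have h1 := Multiset.mem_of_le (hu (c (1 - k)) (c k)) (by
    rw [← eq_corner]; exact (B (s c)).endpt_mem k (!(c k)))
  have h2 : (B (s c)).endpt k (!(c k)) ∈ (B e).mknots k + {u false, u true} := by
    rcases Multiset.mem_cons.1 h1 with h | h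
    · rw [h]
      apply Multiset.mem_add.2 (Or.inr _)
      cases c (1 - k) <;> simp
    · exact Multiset.mem_add.2 (Or.inl h)
  rw [← mknots_inner D W hu] at h2
  have h3 := W.pos_lt c k
  have h4 := W.pos_eq c k
  have h5 := (B (s c)).lo_lt_hi k
  rcases Multiset.mem_add.1 h2 with h | h
  · have h6 := (B f).lo_le h
    have h7 := (B f).le_hi h
    revert h6 h7
    cases c k <;> simp only [pos, endpt, cond, Bool.not_true, Bool.not_false]
    · intro _ h; exact h
    · intro h _; exact neg_le_neg h
  · exfalso
    revert h h3 h4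
    cases c k <;> simp only [pos, endpt, cond, Bool.not_true, Bool.not_false, Multiset.insert_eq_cons,
      Multiset.mem_cons, Multiset.mem_singleton] <;> intro h3 h4 h <;> rcases h with h | h <;> linarith

/-- A B-spline that contains the inner one and whose support does not reach the sides of the outer one
in one direction does not reach them in the other direction either. -/
theorem pos_lt_of_pos_lt (D : Dependent M B) (W : Pinwheel B e f s) {g : BSpline p}
    (hg : g.HasSupport M) (hfg : ∀ k ε, (B f).pos k ε ≤ g.pos k ε) {k : Fin 2}
    (hk : ∀ ε, g.pos k ε < (B e).pos k ε) (δ : Bool) : g.pos (1 - k) δ < (B e).pos (1 - k) δ := by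
  by_contra! hcon
  obtain ⟨v, hv⟩ := exists_le_cons D W k δ
  -- If `g` reaches the side `δ`, it spans the small B-splines there in direction `1 - k`: from that
  -- side up to `f` at least, and they end no further. Its lines cross them, so minimality bounds
  -- the multiplicities.
  have hcount : ∀ ε a, (B (s (corner k δ ε))).Inside k a →
      (g.mknots k).count a ≤ (v ::ₘ (B e).mknots k).count a := by
    intro ε a ha
    refine (count_le_of_pos_le (D.ms _) hg (fun ε' => ?_) ha).trans (Multiset.le_iff_count.1 (hv ε) a)
    refine forall_side (P := fun ε' => (B (s (corner k δ ε))).pos (1 - k) ε' ≤ g.pos (1 - k) ε') δ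
      ?_ ?_ ε'
    · have := W.pos_eq (corner k δ ε) (1 - k)
      rw [corner_other] at this
      exact this.trans_le hcon
    · have := pos_le_inner D W (corner k δ ε) (1 - k)
      rw [corner_other] at this
      exact this.trans (hfg _ _)
  set L := s (corner k δ false) with hL
  set R := s (corner k δ true) with hR
  have hLlo : (B L).supp.lo k = (B e).supp.lo k := W.lo_eq (corner_same _ _ _)
  have hRhi : (B R).supp.hi k = (B e).supp.hi k := W.hi_eq (corner_same _ _ _)
  have hLlt : (B L).supp.hi k < (B e).supp.hi k := by
    have := W.pos_lt (corner k δ false) k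
    rwa [corner_same] at this
  have hRlt : (B e).supp.lo k < (B R).supp.lo k := by
    have := W.pos_lt (corner k δ true) k
    rw [corner_same] at this
    exact neg_lt_neg_iff.1 this
  have hglo : (B e).supp.lo k < g.supp.lo k := neg_lt_neg_iff.1 (hk false)
  have hghi : g.supp.hi k < (B e).supp.hi k := hk true
  have hin : ∀ a ∈ g.mknots k, (B e).supp.lo k < a ∧ a < (B e).supp.hi k := fun a ha =>
    ⟨hglo.trans_le (g.lo_le ha), (g.le_hi ha).trans_lt hghi⟩
  -- the excess knot of `L` and `R`
  obtain ⟨z, hz⟩ := W.exists_excess (corner k δ false)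
  rw [← hL] at hz
  have hzL : z k ∈ (B L).mknots k := Multiset.count_pos.1 ((Nat.zero_le _).trans_lt (hz k).2)
  have hzv : z k = v := by
    by_contra hne
    have := Multiset.le_iff_count.1 (hv false) (z k)
    rw [Multiset.count_cons_of_ne hne] at this
    exact (hz k).2.not_ge this
  -- The excess knot of `L`, paired with the end knot on the side `δ`, can be covered by `R` only.
  -- Hence the supports of `L` and `R` meet at `v`.
  have hzR : z k ∈ (B R).mknots k := by
    have hc := W.count_endpt (corner k δ false) (1 - k)
    rw [corner_other, ← hL] at hc
    obtain ⟨j, hj, h1, h2⟩ := D.cov' L k hzL (v := (B e).endpt (1 - k) δ)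
      (Multiset.count_pos.1 (hc ▸ Multiset.count_pos.2 ((B e).endpt_mem _ _)))
    rw [hc] at h2
    rcases W.eq_of_count_le h2 with rfl | ⟨ε, rfl⟩
    · exact absurd h1 (hz k).2.not_ge
    · cases ε
      · exact absurd rfl hj
      · exact Multiset.count_pos.1 ((Multiset.count_pos.2 hzL).trans_le h1)
  rw [hzv] at hzL hzR
  have h1 := (B R).lo_le hzR
  have h2 := (B L).le_hi hzL
  -- If `L` and `R` only touch, at `v`, a further knot of `g` is a knot of `e` missed by one of them
  -- along with an end knot of `e`; so all knots of `g` equal `v`. If they overlap, every knot of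
  -- `g` is inside one of them, and `g` itself misses both end knots of `e`.
  rcases (h1.trans h2).eq_or_lt with heq | hlt
  · have hall : ∀ a ∈ g.mknots k, a = v := by
      intro a ha
      by_contra hne
      have hmem : ∀ ε, (B (s (corner k δ ε))).Inside k a → a ∈ (B e).mknots k := by
        intro ε h
        have := (Multiset.count_pos.2 ha).trans_le (hcount ε a h)
        rw [Multiset.count_cons_of_ne hne] at this
        exact Multiset.count_pos.1 this
      rcases lt_or_gt_of_ne hne with h | h
      · have haL := hmem false ⟨by rw [← hL, hLlo]; exact (hin a ha).1, h.trans_le h2⟩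
        refine card_contradiction ((B R).card_mknots k) ((B e).card_mknots k) (hin a ha).1.ne ?_ ?_
          ((B e).lo_mem k) haL (hv true)
        · exact fun h' => hRlt.not_ge ((B R).lo_le h')
        · exact fun h' => by have := (B R).lo_le h'; linarith
      · have haR := hmem true ⟨h1.trans_lt h, by rw [← hR, hRhi]; exact (hin a ha).2⟩
        refine card_contradiction ((B L).card_mknots k) ((B e).card_mknots k) (hin a ha).2.ne ?_ ?_
          haR ((B e).hi_mem k) (hv false)
        · exact fun h' => by have := (B L).le_hi h'; linarith
        · exact fun h' => hLlt.not_ge ((B L).le_hi h')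
    have h3 := (g.lo_lt_hi k)
    rw [hall _ (g.lo_mem k), hall _ (g.hi_mem k)] at h3
    exact h3.false
  · refine card_contradiction (g.card_mknots k) ((B e).card_mknots k) (v := v) ((B e).lo_lt_hi k).ne
      (fun h => (hin _ h).1.false) (fun h => (hin _ h).2.false) ((B e).lo_mem k) ((B e).hi_mem k) ?_
    rw [Multiset.le_iff_count]
    intro a
    by_cases ha : a ∈ g.mknots k
    · by_cases haL : a < (B L).supp.hi k
      · exact hcount false a ⟨by rw [← hL, hLlo]; exact (hin a ha).1, haL⟩
      · exact hcount true a ⟨hlt.trans_le (not_lt.1 haL), by rw [← hR, hRhi]; exact (hin a ha).2⟩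
    · rw [Multiset.count_eq_zero.2 ha]; exact Nat.zero_le _

end Pinwheel
end LRSpline

/-! ### The invariant of the LR B-spline algorithm -/

namespace LRSpline
open BSpline
variable {p : Fin 2 → ℕ} {M : Mesh}

namespace BSpline

theorem toSet_subset_iff {B B' : BSpline p} :
    B.supp.toSet ⊆ B'.supp.toSet ↔ ∀ k ε, B.pos k ε ≤ B'.pos k ε := by
  rw [Rect.toSet, Rect.toSet, Set.Icc_subset_Icc_iff fun k => (B.lo_lt_hi k).le]
  constructor
  · rintro ⟨h1, h2⟩ k ε
    cases ε
    exacts [neg_le_neg (h1 k), h2 k]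
  · exact fun h => ⟨fun k => neg_le_neg_iff.1 (h k false), fun k => h k true⟩

theorem HasSupport.mono {M M' : Mesh} {B : BSpline p} (h : B.HasSupport M) (hd : M.dom = M'.dom)
    (hm : ∀ k a s, M.multAbove k a s ≤ M'.multAbove k a s) : B.HasSupport M' :=
  ⟨hd ▸ h.1, fun k a ha s hs => (h.2 k a ha s hs).trans (hm k a s)⟩

theorem coe_insertKnot (t : ℝ) (l : List ℝ) : (insertKnot t l : Multiset ℝ) = t ::ₘ (l : Multiset ℝ) :=
  Multiset.coe_eq_coe.2 (List.perm_orderedInsert _ _ _)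

theorem mknots_insertFirst (B : BSpline p) (k : Fin 2) (t : ℝ) (h1 : B.supp.lo k < t)
    (h2 : t < B.supp.hi k) : (B.insertFirst k t h1 h2).mknots k ≤ t ::ₘ B.mknots k ∧
      (B.insertFirst k t h1 h2).mknots (1 - k) = B.mknots (1 - k) := by
  constructor
  · rw [mknots, mknots, ← coe_insertKnot]
    simp only [insertFirst, replace, Function.update_self]
    exact (List.dropLast_sublist _).subperm
  · simp [mknots, insertFirst, replace, one_sub_ne]

theorem mknots_insertLast (B : BSpline p) (k : Fin 2) (t : ℝ) (h1 : B.supp.lo k < t)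
    (h2 : t < B.supp.hi k) : (B.insertLast k t h1 h2).mknots k ≤ t ::ₘ B.mknots k ∧
      (B.insertLast k t h1 h2).mknots (1 - k) = B.mknots (1 - k) := by
  constructor
  · rw [mknots, mknots, ← coe_insertKnot]
    simp only [insertLast, replace, Function.update_self]
    exact (List.tail_sublist _).subperm
  · simp [mknots, insertLast, replace, one_sub_ne]

theorem pos_le_of_knot_insertion {B C : BSpline p} {k : Fin 2} {t : ℝ} (h1 : B.supp.lo k < t)
    (h2 : t < B.supp.hi k) (hk : C.mknots k ≤ t ::ₘ B.mknots k)
    (hk' : C.mknots (1 - k) = B.mknots (1 - k)) : ∀ j ε, C.pos j ε ≤ B.pos j ε := by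
  have key : ∀ a ∈ C.mknots k, B.supp.lo k ≤ a ∧ a ≤ B.supp.hi k := by
    intro a ha
    rcases Multiset.mem_cons.1 (Multiset.mem_of_le hk ha) with rfl | h
    exacts [⟨h1.le, h2.le⟩, ⟨B.lo_le h, B.le_hi h⟩]
  refine forall_dir k (fun ε => ?_) fun ε => (pos_eq_of_mknots_eq hk' ε).le
  cases ε
  exacts [neg_le_neg (key _ (C.lo_mem k)).1, (key _ (C.hi_mem k)).2]

theorem HasSupport.of_knot_insertion {B C : BSpline p} (hB : B.HasSupport M) {k : Fin 2} {t : ℝ}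
    (h1 : B.supp.lo k < t) (h2 : t < B.supp.hi k) (hk : C.mknots k ≤ t ::ₘ B.mknots k)
    (hk' : C.mknots (1 - k) = B.mknots (1 - k))
    (ht : ∀ s ∈ Set.Ico (B.supp.lo (1 - k)) (B.supp.hi (1 - k)),
      (B.knots k).count t < M.multAbove k t s) : C.HasSupport M := by
  have hpos := pos_le_of_knot_insertion h1 h2 hk hk'
  refine ⟨(toSet_subset_iff.2 hpos).trans hB.1, fun j a _ s hs => ?_⟩
  have hs' : s ∈ Set.Ico (B.supp.lo (1 - j)) (B.supp.hi (1 - j)) :=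
    ⟨(neg_le_neg_iff.1 (hpos _ false)).trans hs.1, hs.2.trans_le (hpos _ true)⟩
  rw [← count_mknots]
  clear hs
  revert j
  refine forall_dir k ?_ ?_
  · intro _ hs'
    have hle := Multiset.le_iff_count.1 hk a
    have := hB.carries k a s hs'
    by_cases hat : a = t
    -- The strict inequality in `ht` pays for the additional copy of `t`.
    · subst hat
      rw [Multiset.count_cons_self, count_mknots B] at hle
      exact hle.trans (ht s hs')
    · rw [Multiset.count_cons_of_ne hat] at hle
      exact hle.trans this
  · intro _ hs'
    rw [hk']
    exact hB.carries (1 - k) a s hs'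

end BSpline

theorem Mesh.multAbove_le_insert (M : Mesh) (γ : Split) (k : Fin 2) (a s : ℝ) :
    M.multAbove k a s ≤ (M.insert γ).multAbove k a s := by
  simp [Mesh.multAbove, Mesh.insert]

theorem count_le_multAbove_tensorMesh (T : Fin 2 → List ℝ) (k : Fin 2) (a : ℝ) {s : ℝ}
    (hs : s ∈ Set.Ico (firstKnot (T (1 - k))) (lastKnot (T (1 - k)))) :
    (T k).count a ≤ (tensorMesh T).multAbove k a s := by
  have key : ∀ (l : List ℝ), (l.map fun x => if x = a then 1 else 0).sum = l.count a := by
    intro l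
    induction l with
    | nil => simp
    | cons b l ih => simp [List.count_cons, ih, add_comm]
  have h1 := hs.1
  have h2 := hs.2
  rw [← key]
  fin_cases k
  · have h1' : firstKnot (T 1) ≤ s := h1
    have h2' : s < lastKnot (T 1) := h2
    simp [Mesh.multAbove, tensorMesh, Function.comp_def, h1', h2']
  · have h1' : firstKnot (T 0) ≤ s := h1
    have h2' : s < lastKnot (T 0) := h2
    simp [Mesh.multAbove, tensorMesh, Function.comp_def, h1', h2']

theorem hasSupport_tensorMesh {T : Fin 2 → List ℝ} (hT : IsInitial p T) {g : BSpline p}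
    (hg : g ∈ tensorBSplines p T) : g.HasSupport (tensorMesh T) := by
  have hmem : ∀ k, ∀ a ∈ g.mknots k, firstKnot (T k) ≤ a ∧ a ≤ lastKnot (T k) := fun k a ha =>
    ⟨firstKnot_le (hT k).1 ((hg k).subset ha), le_lastKnot (hT k).1 ((hg k).subset ha)⟩
  refine ⟨Set.Icc_subset_Icc (fun k => (hmem k _ (g.lo_mem k)).1) fun k => (hmem k _ (g.hi_mem k)).2,
    fun k a _ s hs => ((hg k).sublist.count_le a).trans (count_le_multAbove_tensorMesh T k a ?_)⟩
  exact ⟨(hmem _ _ (g.lo_mem _)).1.trans hs.1, hs.2.trans_le (hmem _ _ (g.hi_mem _)).2⟩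

/-- The support of `g` contains that of `f`, and in one direction it lies strictly inside the support
of `e`. -/
def IsTrapped (e f g : BSpline p) : Prop :=
  (∀ k ε, f.pos k ε ≤ g.pos k ε) ∧ ∃ k, ∀ ε, g.pos k ε < e.pos k ε

/-- Lines of the tensor mesh run through the whole domain. If `g` were strictly inside `e` in
direction `k`, all its knots there would be knots of `e` by minimality, hence the knots of `e` would
be those of `g`. -/
theorem not_isTrapped_of_mem_tensorBSplines {T : Fin 2 → List ℝ} {e f g : BSpline p}
    (he : e.HasMinimalSupport M) (hd : (tensorMesh T).dom = M.dom)
    (hm : ∀ k a s, (tensorMesh T).multAbove k a s ≤ M.multAbove k a s)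
    (hg : g ∈ tensorBSplines p T) : ¬ IsTrapped e f g := by
  rintro ⟨-, k, hk⟩
  have hdom : ∀ j, firstKnot (T j) ≤ e.supp.lo j ∧ e.supp.hi j ≤ lastKnot (T j) := by
    have h := he.1.1
    rw [← hd, Rect.toSet, Rect.toSet, Set.Icc_subset_Icc_iff fun k => (e.lo_lt_hi k).le] at h
    exact fun j => ⟨h.1 j, h.2 j⟩
  have hle : g.mknots k ≤ e.mknots k := by
    rw [Multiset.le_iff_count]
    intro a
    by_cases ha : a ∈ g.mknots k
    · refine he.le_count ⟨(neg_lt_neg_iff.1 (hk false)).trans_le (g.lo_le ha),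
        (g.le_hi ha).trans_lt (hk true)⟩ fun s hs => ?_
      rw [count_mknots]
      exact ((hg k).sublist.count_le a).trans ((count_le_multAbove_tensorMesh T k a
        ⟨(hdom _).1.trans hs.1, hs.2.trans_le (hdom _).2⟩).trans (hm k a s))
    · rw [Multiset.count_eq_zero.2 ha]; exact Nat.zero_le _
  have := Multiset.eq_of_le_of_card_le hle (by rw [card_mknots, card_mknots])
  exact (hk true).ne (pos_eq_of_mknots_eq this true)

variable {B : Fin 6 → BSpline p} {e f : Fin 6} {s : (Fin 2 → Bool) → Fin 6}

/-- A trapped `C` is strictly inside `e` in both directions. In the direction `1 - k`, untouched by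
the insertion, `g` has the same extent, so `g` would be trapped too. -/
theorem Pinwheel.not_isTrapped_of_knot_insertion (D : Dependent M B) (W : Pinwheel B e f s)
    {g C : BSpline p} {k : Fin 2} {t : ℝ} (h1 : g.supp.lo k < t) (h2 : t < g.supp.hi k)
    (hk : C.mknots k ≤ t ::ₘ g.mknots k) (hk' : C.mknots (1 - k) = g.mknots (1 - k))
    (hC : C.HasSupport M) (hg : ¬ IsTrapped (B e) (B f) g) : ¬ IsTrapped (B e) (B f) C := by
  rintro ⟨hf, j, hj⟩
  have hall : ∀ i ε, C.pos i ε < (B e).pos i ε :=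
    forall_dir j hj (W.pos_lt_of_pos_lt D hC hf hj)
  have hpos := pos_le_of_knot_insertion h1 h2 hk hk'
  refine hg ⟨fun i ε => (hf i ε).trans (hpos i ε), 1 - k, fun ε => ?_⟩
  rw [← pos_eq_of_mknots_eq hk' ε]
  exact hall _ ε

/-- Support on the current mesh is carried along because the insertion step needs it. Comparing `M'`
with the final mesh `M` lets the induction pass through all earlier meshes. -/
theorem Pinwheel.hasSupport_and_not_isTrapped (D : Dependent M B) (W : Pinwheel B e f s) {M' : Mesh}
    {S : Set (BSpline p)} (hS : IsLRCollection p M' S) (hd : M'.dom = M.dom)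
    (hm : ∀ k a s, M'.multAbove k a s ≤ M.multAbove k a s) :
    ∀ g ∈ S, g.HasSupport M' ∧ ¬ IsTrapped (B e) (B f) g := by
  induction hS with
  | tensor T hT =>
    exact fun g hg => ⟨hasSupport_tensorMesh hT hg,
      not_isTrapped_of_mem_tensorBSplines (D.ms e) hd hm hg⟩
  | insert M₀ γ S S' _ _ hrun hfinal ih =>
    have hins := M₀.multAbove_le_insert γ
    have h0 : ∀ g ∈ S, g.HasSupport (M₀.insert γ) ∧ ¬ IsTrapped (B e) (B f) g := by
      intro g hg
      obtain ⟨h1, h2⟩ := ih hd (fun k a s => (hins k a s).trans (hm k a s)) g hg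
      exact ⟨h1.mono rfl hins, h2⟩
    clear ih hfinal
    induction hrun with
    | refl => exact h0
    | tail _ hstep ih =>
      obtain ⟨g, hg, -, k, t, h1, h2, ht, rfl⟩ := hstep
      obtain ⟨hgs, hgt⟩ := ih g hg
      have key : ∀ C : BSpline p, C.mknots k ≤ t ::ₘ g.mknots k →
          C.mknots (1 - k) = g.mknots (1 - k) →
          C.HasSupport (M₀.insert γ) ∧ ¬ IsTrapped (B e) (B f) C := by
        intro C hk hk'
        have hC := hgs.of_knot_insertion h1 h2 hk hk' ht
        exact ⟨hC, W.not_isTrapped_of_knot_insertion D h1 h2 hk hk' (hC.mono hd hm) hgt⟩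
      rintro C (⟨hC, -⟩ | rfl | rfl)
      · exact ih C hC
      · exact key _ (mknots_insertFirst g k t h1 h2).1 (mknots_insertFirst g k t h1 h2).2
      · exact key _ (mknots_insertLast g k t h1 h2).1 (mknots_insertLast g k t h1 h2).2

theorem Pinwheel.not_isLRBSpline (D : Dependent M B) (W : Pinwheel B e f s) :
    ¬ IsLRBSpline M (B f) := by
  rintro ⟨S, hS, hf⟩
  exact (W.hasSupport_and_not_isTrapped D hS rfl (fun _ _ _ => le_rfl) _ hf).2
    ⟨fun _ _ => le_rfl, 0, W.inner 0⟩

/-! ### Pinwheels and labellings -/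

theorem Pinwheel.isNestedAt (W : Pinwheel B e f s) (c : Fin 2 → Bool) :
    (B (s c)).IsNestedAt (fun k => (B e).endpt k (c k)) (B e) := by
  have hv : (fun k => (B e).endpt k (c k)) ∈ (B (s c)).supp.vertices := fun k => by
    beta_reduce
    rw [← endpt_eq_of_pos_eq (W.pos_eq c k)]
    cases c k <;> simp [endpt]
  have hv' : (fun k => (B e).endpt k (c k)) ∈ (B e).supp.vertices := fun k => by
    beta_reduce
    cases c k <;> simp [endpt]
  refine ⟨⟨toSet_subset_iff.2 (W.pos_le (s c)), _, ⟨hv, hv'⟩, ?_⟩, hv, hv'⟩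
  rintro w ⟨h1, h2⟩
  funext k
  have h3 := h1 k
  have h4 := h2 k
  have h5 := W.pos_lt c k
  have h6 := W.pos_eq c k
  have h7 := (B (s c)).lo_lt_hi k
  revert h5 h6
  cases c k <;> simp only [pos, endpt, cond, Bool.not_true, Bool.not_false] <;> intro h5 h6 <;>
    rcases h3 with h3 | h3 <;> rcases h4 with h4 | h4 <;> linarith

theorem Pinwheel.exists_isLabelling (W : Pinwheel B e f s) :
    ∃ σ : Equiv.Perm (Fin 6), IsLabelling (B ∘ σ) := by
  let τ : Fin 6 → Fin 6 := ![e, s ![false, false], s ![false, true], s ![true, true],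
    s ![true, false], f]
  have hτ : Function.Surjective τ := by
    intro i
    rcases W.exhaust i with rfl | rfl | ⟨c, rfl⟩
    · exact ⟨0, rfl⟩
    · exact ⟨5, rfl⟩
    · have hc : c = ![c 0, c 1] := by ext k; fin_cases k <;> rfl
      rw [hc]
      cases c 0 <;> cases c 1
      exacts [⟨1, rfl⟩, ⟨2, rfl⟩, ⟨4, rfl⟩, ⟨3, rfl⟩]
  have hv : ∀ x y : Bool, (fun k => (B e).endpt k (![x, y] k)) = ![(B e).endpt 0 x, (B e).endpt 1 y] :=
    fun x y => by ext k; fin_cases k <;> rfl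
  refine ⟨Equiv.ofBijective τ (Finite.surjective_iff_bijective.1 hτ), ?_, ?_, ?_, ?_, ?_⟩
  · refine subset_antisymm (Set.subset_iUnion (fun j => (B (τ j)).supp.toSet) 0)
      (Set.iUnion_subset fun j => toSet_subset_iff.2 (W.pos_le (τ j)))
  · have := W.isNestedAt ![false, false]; rwa [hv] at this
  · have := W.isNestedAt ![false, true]; rwa [hv] at this
  · have := W.isNestedAt ![true, true]; rwa [hv] at this
  · have := W.isNestedAt ![true, false]; rwa [hv] at this

/-- Only `e` contains all supports, and `f` shares no vertex with `e`, so `f` takes none of the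
first five labels. -/
theorem Pinwheel.apply_five_eq (W : Pinwheel B e f s) {σ : Equiv.Perm (Fin 6)}
    (hσ : IsLabelling (B ∘ σ)) : σ 5 = f := by
  obtain ⟨h0, h1, h2, h3, h4⟩ := hσ
  have hsub : (B e).supp.toSet ⊆ (B (σ 0)).supp.toSet := by
    refine Set.Subset.trans ?_ h0.ge
    have := Set.subset_iUnion (fun j => ((B ∘ σ) j).supp.toSet) (σ.symm e)
    simpa using this
  rw [toSet_subset_iff] at hsub
  have hσ0 : σ 0 = e := by
    rcases W.exhaust (σ 0) with h | h | ⟨c, h⟩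
    · exact h
    · rw [h] at hsub; exact absurd (hsub 0 true) (W.inner 0 true).not_ge
    · rw [h] at hsub; exact absurd (hsub 0 _) (W.pos_lt c 0).not_ge
  have hnest : ∀ j v, (B (σ j)).IsNestedAt v (B (σ 0)) → σ j ≠ f := by
    intro j v hj hjf
    rw [hσ0, hjf] at hj
    have k1 := hj.2.1 0
    have k2 := hj.2.2 0
    have k3 := W.lo_lt_inner 0
    have k4 := W.inner_lt_hi 0
    have k5 := (B f).lo_lt_hi 0
    rcases k1 with k1 | k1 <;> rcases k2 with k2 | k2 <;> linarith
  obtain ⟨j, hj⟩ := σ.surjective f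
  have hef : e ≠ f := fun h => (W.inner 0 true).ne (by rw [h])
  fin_cases j
  · exact absurd (hσ0.symm.trans hj) hef
  · exact absurd hj (hnest 1 _ h1)
  · exact absurd hj (hnest 2 _ h2)
  · exact absurd hj (hnest 3 _ h3)
  · exact absurd hj (hnest 4 _ h4)
  · exact hj

theorem dependent_of_sum_eq_zero (hB : Function.Injective B) (hMS : ∀ j, (B j).HasMinimalSupport M)
    {α : Fin 6 → ℝ} (hα : ∀ j, α j ≠ 0)
    (hrel : ∀ z : Fin 2 → ℝ, ∑ j, α j * (B j).eval z = 0) : Dependent M B := by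
  obtain ⟨β, hβ, h⟩ := exists_sum_dd_eq_zero B α hα hrel
  refine ⟨hB, hMS, forall_dir 0 ⟨β, hβ, h⟩ ⟨β, hβ, fun f g => ?_⟩⟩
  rw [← h g f]
  exact Finset.sum_congr rfl fun j _ => mul_right_comm _ _ _

end LRSpline

theorem proposition6p8 (p : Fin 2 → ℕ) (M : LRSpline.Mesh) (hM : LRSpline.IsLRMesh p M)
    (B : Fin 6 → LRSpline.BSpline p) (hB : Function.Injective B)
    (hMS : ∀ j, (B j).HasMinimalSupport M)
    (α : Fin 6 → ℝ) (hα : ∀ j, α j ≠ 0)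
    (hrel : ∀ z : Fin 2 → ℝ, ∑ j, α j * (B j).eval z = 0) :
    (∃ σ : Equiv.Perm (Fin 6), LRSpline.IsLabelling (B ∘ σ)) ∧
    ∀ σ : Equiv.Perm (Fin 6), LRSpline.IsLabelling (B ∘ σ) →
      ¬ LRSpline.IsLRBSpline M (B (σ 5)) := by
  have D := LRSpline.dependent_of_sum_eq_zero hB hMS hα hrel
  obtain ⟨e, f, s, W⟩ := D.exists_pinwheel
  refine ⟨W.exists_isLabelling, fun σ hσ => ?_⟩
  rw [W.apply_five_eq hσ]
  exact W.not_isLRBSpline D
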